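/- **Proposition (Soundness and completeness of qOTL with unbounded duality).** *Setting.* Let $V_1,V_2$ be finite sets of quantum variables, each variable having a finite dimension $\ge 1$, and let $\mathcal H_1,\mathcal H_2$ be the corresponding finite-dimensional state spaces. qWhile programs over $V_i$ are built from $\mathbf{skip}$, initialization $Q:=|w\rangle$ of a register $Q\subseteq V_i$ in a unit vector $w$, unitaries $Q:=U[Q]$, sequential composition $c;c'$, $\mathbf{if}\,(\square m\cdot M[Q]=m\to c_m)\,\mathbf{fi}$ with a finite-outcome measurement $M$ ($\sum_m M_m^\dagger M_m=I$), and $\mathbf{while}\,M[Q]=1\,\mathbf{do}\,c\,\mathbf{od}$ with a two-outcome measurement. Programs are identified up to associativity of $;$ and $\mathbf{skip};c=c=c;\mathbf{skip}$. The denotational semantics $[\![c]\!]$ is the usual one, with $[\![\mathbf{while}]\!](\rho)=\sum_{k\ge 0}M_0\big(([\![c]\!]\circ \mathcal M_1)^k(\rho)\big)M_0^\dagger$, where $\mathcal M_1(\tau)=M_1\tau M_1^\dagger$. A program $c$ is almost surely terminating (AST) if $\operatorname{tr}[\![c]\!](\rho)=\operatorname{tr}\rho$ for all partial density operators $\rho$.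 *Assertions.* An infinite-valued predicate is $A=\sum_j\lambda_jX_j$ with $\lambda_j\in[0,+\infty]$ and pairwise orthogonal projections $X_j$ with $\sum_jX_j=I$; $\operatorname{tr}(A\rho)=\sum_j\lambda_j\operatorname{tr}(X_j\rho)$ with $0\cdot\infty=0$. Sums and $\sum_kK_k^\dagger A_kK_k$ are defined accordingly, and $A\sqsubseteq B$ means $\langle v|A|v\rangle\le\langle v|B|v\rangle$ for all $v$. Assertions $\psi,\phi$ are infinite-valued predicates on $\mathcal H_1\otimes\mathcal H_2$. *Validity.* A partial coupling of partial density operators $\rho_1,\rho_2$ is a positive $\sigma$ on $\mathcal H_1\otimes \mathcal H_2$ with $\operatorname{tr}_2\sigma\sqsubseteq\rho_1$, $\operatorname{tr}_1\sigma\sqsubseteq\rho_2$ and $\operatorname{tr}\rho_1+\operatorname{tr}\rho_2\le 1+\operatorname{tr}\sigma$; a coupling is a positive $\sigma$ with $\operatorname{tr}_2\sigma=\rho_1$, $\operatorname{tr}_1\sigma=\rho_2$. The judgment $\{\psi\}\,c_1\sim c_2\,\{\phi\}$ is valid, $\models\{\psi\}\,c_1\sim c_2\,\{\phi\}$, if for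 every density operator $\rho$ on $\mathcal H_1\otimes\mathcal H_2$ there is a partial coupling $\sigma$ of $[\![c_1]\!](\operatorname{tr}_2\rho)$ and $[\![c_2]\!](\operatorname{tr}_1\rho)$ with $\operatorname{tr}(\phi\sigma)\le\operatorname{tr}(\psi\rho)$. *Proof system.* $\vdash$ is the least relation closed under the following rules, where left operators act as $K\otimes I$ and right operators as $I\otimes K$. - One-sided: $\vdash\{\sum_i|i\rangle\langle w|\psi|w\rangle\langle i|\}\;Q:=|w\rangle\sim\mathbf{skip}\;\{\psi\}$; $\vdash\{U^\dagger\psi U\}\;Q:=U[Q]\sim\mathbf{skip}\;\{\psi\}$; from $\vdash\{\xi_m\}c_m\sim c_2\{\phi\}$ for all $m$ infer $\vdash\{\sum_mM_m^\dagger\xi_mM_m\}\,\mathbf{if}\sim c_2\,\{\phi\}$; with $W=M_0^\dagger\phi M_0+M_1^\dagger\xi M_1$, from $\vdash\{\xi\}c\sim\mathbf{skip}\{W\}$ infer $\vdash\{W\}\,\mathbf{while}\sim\mathbf{skip}\,\{\phi\}$; and the symmetric right rules. - Two-sided: $\vdash\{\psi\}\mathbf{skip}\sim\mathbf{skip}\{\psi\}$;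 two initializations or two unitaries at once; sequential composition; from $\vdash\{\xi_m\}c_m\sim c_m'\{\phi\}$ for all $m$ and the measurement condition $M\approx M':\psi\Rightarrow(\xi_m)_m$ infer $\vdash\{\psi\}\,\mathbf{if}\sim\mathbf{if}\,\{\phi\}$; from $\vdash\{\xi\}c\sim c'\{\psi\}$ and $M\approx M':\psi\Rightarrow(\phi,\xi)$ infer $\vdash\{\psi\}\,\mathbf{while}\sim\mathbf{while}\,\{\phi\}$. The condition $M\approx M':\psi\Rightarrow(\xi_m)_m$ says that for every partial density operator $\rho$ with $\operatorname{tr}(\psi\rho)<\infty$ there are couplings $\sigma_m$ of $M_m(\operatorname{tr}_2\rho)M_m^\dagger$ and $M'_m(\operatorname{tr}_1\rho)M_m'^\dagger$ with $\sum_m\operatorname{tr}(\xi_m\sigma_m)\le\operatorname{tr}(\psi\rho)$. - Structural: from $\psi'\sqsubseteq\psi$, $\vdash\{\psi'\}c_1\sim c_2\{\phi'\}$, $\phi\sqsubseteq\phi'$ infer $\vdash\{\psi\}c_1\sim c_2\{\phi\}$. - Unbounded duality (and its special case for $\phi$ without eigenvalue $+\infty$): if $c_1,c_2$ are AST and $\vdash\{\psi+n\cdot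 id\}c_1\sim c_2\{\phi_1\otimes id+id\otimes\phi_2\}$ for all $n\in\mathbb N$ and positive operators $\phi_1$ on $\mathcal H_1$, $\phi_2$ on $\mathcal H_2$ with $\phi_1\otimes id+id\otimes\phi_2\sqsubseteq\phi+n\cdot id$, infer $\vdash\{\psi\}c_1\sim c_2\{\phi\}$. *Claim.* For all AST programs $c_1$ over $V_1$ and $c_2$ over $V_2$, and all infinite-valued assertions $\psi,\phi$, $$\vdash\{\psi\}\,c_1\sim c_2\,\{\phi\}\quad\Longleftrightarrow\quad\models\{\psi\}\,c_1\sim c_2\,\{\phi\}.$$ The same equivalence holds when validity is instead defined by requiring, for every partial density operator $\rho$ on $\mathcal H_1\otimes\mathcal H_2$, a coupling $\sigma$ of the two outputs with $\operatorname{tr}(\phi\sigma)\le\operatorname{tr}(\psi\rho)$. -/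

import Mathlib

open scoped Matrix Kronecker ENNReal ComplexOrder

noncomputable section

namespace QOTL

/-! ### Infinite-valued predicates -/

/-- An infinite-valued predicate on the Hilbert space `ℂ^ι`, i.e. an operator
`A = ∑ j, λ j • X j` with eigenvalues `λ j ∈ [0, +∞]` and pairwise orthogonal
eigenprojections `X j` summing to the identity.  Such an `A` is the same as the pair of
the positive operator `fin = ∑ (λ j < ∞), λ j • X j` and the projection
`inf = ∑ (λ j = ∞), X j`, which are orthogonal to one another; one writes
`A = fin + ∞ • inf`. -/
@[ext]
structure InfPred (ι : Type*) [Fintype ι] [DecidableEq ι] where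
  /-- the finite part -/
  fin : Matrix ι ι ℂ
  /-- the projection onto the eigenspace of the eigenvalue `+∞` -/
  inf : Matrix ι ι ℂ
  fin_posSemidef : fin.PosSemidef
  inf_isHermitian : inf.IsHermitian
  inf_mul_inf : inf * inf = inf
  inf_mul_fin : inf * fin = 0

/-- The projection onto the support (orthogonal complement of the kernel) of a Hermitian
matrix. -/
def suppProj {ι : Type*} [Fintype ι] [DecidableEq ι] (S : Matrix ι ι ℂ) : Matrix ι ι ℂ :=
  cfc (fun x : ℝ => if x = 0 then (0 : ℝ) else 1) S

section suppProj
variable {ι : Type*} [Fintype ι] [DecidableEq ι]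

theorem suppProj_isHermitian (S : Matrix ι ι ℂ) : (suppProj S).IsHermitian :=
  cfc_predicate (R := ℝ) (p := IsSelfAdjoint) _ S

theorem suppProj_mul_self (S : Matrix ι ι ℂ) : suppProj S * suppProj S = suppProj S := by
  by_cases hS : IsSelfAdjoint S
  · have hc : ContinuousOn (fun x : ℝ => if x = 0 then (0 : ℝ) else 1) (spectrum ℝ S) :=
      (Matrix.finite_real_spectrum (A := S)).continuousOn _
    unfold suppProj
    rw [← cfc_mul _ _ S hc hc]
    congr 1
    ext x
    split_ifs <;> simp
  · simp [suppProj, cfc_apply_of_not_predicate S hS]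

end suppProj

namespace InfPred

variable {ι : Type*} [Fintype ι] [DecidableEq ι]

/-- The expectation `tr (A ρ) ∈ [0, +∞]` of a predicate in a positive operator `ρ`, with the
convention `0 * ∞ = 0`: it is infinite unless `ρ` is orthogonal to the `+∞`-eigenspace. -/
def expect (A : InfPred ι) (ρ : Matrix ι ι ℂ) : ℝ≥0∞ :=
  open Classical in
  if A.inf * ρ = 0 then ENNReal.ofReal (A.fin * ρ).trace.re else ⊤

/-- The quadratic form `⟨v|A|v⟩ ∈ [0, +∞]`. -/
def qform (A : InfPred ι) (v : ι → ℂ) : ℝ≥0∞ :=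
  A.expect (Matrix.vecMulVec v (star v))

/-- The Löwner order. -/
instance : LE (InfPred ι) where
  le A B := ∀ v : ι → ℂ, A.qform v ≤ B.qform v

/-- A positive operator as a predicate. -/
def ofPos (P : Matrix ι ι ℂ) (hP : P.PosSemidef) : InfPred ι where
  fin := P
  inf := 0
  fin_posSemidef := hP
  inf_isHermitian := Matrix.isHermitian_zero
  inf_mul_inf := by simp
  inf_mul_fin := by simp

/-- The predicate `P + ∞ • S` for a positive operator `P` and a positive operator `S`: it is
`+∞` on the support of `S`, and `P` compressed to the kernel of `S` elsewhere. -/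
def ofParts (P S : Matrix ι ι ℂ) (hP : P.PosSemidef) : InfPred ι where
  fin := (1 - suppProj S) * P * (1 - suppProj S)
  inf := suppProj S
  fin_posSemidef := by
    have h : (1 - suppProj S)ᴴ = 1 - suppProj S := by
      rw [Matrix.conjTranspose_sub, Matrix.conjTranspose_one, suppProj_isHermitian S]
    have := hP.mul_mul_conjTranspose_same (1 - suppProj S)
    rwa [h] at this
  inf_isHermitian := suppProj_isHermitian S
  inf_mul_inf := suppProj_mul_self S
  inf_mul_fin := by
    have h : suppProj S * (1 - suppProj S) = 0 := by
      rw [mul_sub, suppProj_mul_self, mul_one, sub_self]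
    rw [← mul_assoc, ← mul_assoc, h, zero_mul, zero_mul]

/-- Addition: `A + B = (fin A + fin B) + ∞ • (inf A ∨ inf B)`. -/
instance : Add (InfPred ι) where
  add A B := ofParts (A.fin + B.fin) (A.inf + B.inf) (A.fin_posSemidef.add B.fin_posSemidef)

/-- The predicate `n • id`. -/
def natId (n : ℕ) : InfPred ι :=
  ofPos ((n : ℂ) • (1 : Matrix ι ι ℂ)) (Matrix.PosSemidef.one.smul (Nat.cast_nonneg n))

/-- The predicate `∑ k, (K k)† (A k) (K k)`. -/
def kraus {κ : Type*} [Fintype κ] (K : κ → Matrix ι ι ℂ) (A : κ → InfPred ι) : InfPred ι :=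
  ofParts (∑ k, (K k)ᴴ * (A k).fin * K k) (∑ k, (K k)ᴴ * (A k).inf * K k)
    (Matrix.posSemidef_sum _ fun k _ => (A k).fin_posSemidef.conjTranspose_mul_mul_same (K k))

end InfPred

/-! ### Quantum registers and measurements -/

section Registers

variable {V : Type*} [Fintype V] [DecidableEq V]

/-- The computational basis of the state space of all quantum variables, where the variable
`v` has dimension `d v`.  The state space itself is `ℂ ^ Basis d`. -/
abbrev Basis (d : V → ℕ) : Type _ := ∀ v : V, Fin (d v)

/-- The computational basis of the state space of the register `Q`. -/
abbrev RegBasis (d : V → ℕ) (Q : Finset V) : Type _ := ∀ v : Q, Fin (d v)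

/-- The operator `A` on the register `Q`, extended by the identity to all variables. -/
def lift {d : V → ℕ} (Q : Finset V) (A : Matrix (RegBasis d Q) (RegBasis d Q) ℂ) :
    Matrix (Basis d) (Basis d) ℂ :=
  Matrix.of fun x y =>
    if ∀ v, v ∉ Q → x v = y v then A (fun v => x v) (fun v => y v) else 0

/-- A measurement on the register `Q` with `n` outcomes. -/
structure Measurement (d : V → ℕ) (Q : Finset V) (n : ℕ) where
  op : Fin n → Matrix (RegBasis d Q) (RegBasis d Q) ℂ
  complete : ∑ m, (op m)ᴴ * op m = 1

/-- The measurement operator for the outcome `m`, on the space of all variables. -/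
def Measurement.lifted {d : V → ℕ} {Q : Finset V} {n : ℕ} (M : Measurement d Q n) (m : Fin n) :
    Matrix (Basis d) (Basis d) ℂ :=
  lift Q (M.op m)

/-- The operator `|w⟩⟨i|` on the register `Q`, on the space of all variables. -/
def initKraus {d : V → ℕ} (Q : Finset V) (w : RegBasis d Q → ℂ) (i : RegBasis d Q) :
    Matrix (Basis d) (Basis d) ℂ :=
  lift Q (Matrix.vecMulVec w (Pi.single i 1))

end Registers

/-! ### The language qWhile -/

section Language

variable {V : Type*} [Fintype V] [DecidableEq V]

/-- qWhile programs over the quantum variables `V`. -/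
inductive Prog (d : V → ℕ) : Type _
  /-- `skip` -/
  | skip : Prog d
  /-- `Q := |w⟩` -/
  | init (Q : Finset V) (w : RegBasis d Q → ℂ) (hw : ∑ i, ‖w i‖ ^ 2 = 1) : Prog d
  /-- `Q := U[Q]` -/
  | apply (Q : Finset V) (U : Matrix.unitaryGroup (RegBasis d Q) ℂ) : Prog d
  /-- `c; c'` -/
  | seq (c c' : Prog d) : Prog d
  /-- `if (□ m · M[Q] = m → S m) fi` -/
  | cond (Q : Finset V) (n : ℕ) (M : Measurement d Q n) (S : Fin n → Prog d) : Prog d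
  /-- `while M[Q] = 1 do c od` -/
  | loop (Q : Finset V) (M : Measurement d Q 2) (c : Prog d) : Prog d

namespace Prog

/-- The denotational semantics. -/
def sem {d : V → ℕ} : Prog d → Matrix (Basis d) (Basis d) ℂ → Matrix (Basis d) (Basis d) ℂ
  | skip, ρ => ρ
  | init Q w _, ρ => ∑ i, initKraus Q w i * ρ * (initKraus Q w i)ᴴ
  | apply Q U, ρ => lift Q U.1 * ρ * (lift Q U.1)ᴴ
  | seq c c', ρ => c'.sem (c.sem ρ)
  | cond _ _ M S, ρ => ∑ m, (S m).sem (M.lifted m * ρ * (M.lifted m)ᴴ)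
  | loop _ M c, ρ =>
      ∑' k : ℕ, M.lifted 0 *
        (fun τ => c.sem (M.lifted 1 * τ * (M.lifted 1)ᴴ))^[k] ρ * (M.lifted 0)ᴴ

/-- Almost sure termination: every (partial) state is mapped to a state of the same trace. -/
def AST {d : V → ℕ} (c : Prog d) : Prop :=
  ∀ ρ : Matrix (Basis d) (Basis d) ℂ, ρ.PosSemidef → ρ.trace.re ≤ 1 →
    (c.sem ρ).trace = ρ.trace

/-- The usual syntactic identifications of programs: `;` is associative with unit `skip`. -/
inductive Same {d : V → ℕ} : Prog d → Prog d → Prop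
  | refl (c) : Same c c
  | symm {c c'} : Same c c' → Same c' c
  | trans {c c' c''} : Same c c' → Same c' c'' → Same c c''
  | skip_seq (c) : Same (seq skip c) c
  | seq_skip (c) : Same (seq c skip) c
  | assoc (c c' c'') : Same (seq (seq c c') c'') (seq c (seq c' c''))
  | seq_congr {a a' b b'} : Same a a' → Same b b' → Same (seq a b) (seq a' b')
  | cond_congr (Q n) (M : Measurement d Q n) {S S' : Fin n → Prog d} :
      (∀ m, Same (S m) (S' m)) → Same (cond Q n M S) (cond Q n M S')
  | loop_congr (Q) (M : Measurement d Q 2) {c c'} :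
      Same c c' → Same (loop Q M c) (loop Q M c')

end Prog

end Language

/-! ### Couplings -/

section Couplings

variable {ι₁ ι₂ : Type*} [Fintype ι₁] [Fintype ι₂] [DecidableEq ι₁] [DecidableEq ι₂]

/-- The partial trace over the second system. -/
def trace₂ (σ : Matrix (ι₁ × ι₂) (ι₁ × ι₂) ℂ) : Matrix ι₁ ι₁ ℂ :=
  Matrix.of fun i i' => ∑ j, σ (i, j) (i', j)

/-- The partial trace over the first system. -/
def trace₁ (σ : Matrix (ι₁ × ι₂) (ι₁ × ι₂) ℂ) : Matrix ι₂ ι₂ ℂ :=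
  Matrix.of fun j j' => ∑ i, σ (i, j) (i, j')

/-- `σ` is a coupling of `ρ₁` and `ρ₂`. -/
structure IsCoupling (σ : Matrix (ι₁ × ι₂) (ι₁ × ι₂) ℂ)
    (ρ₁ : Matrix ι₁ ι₁ ℂ) (ρ₂ : Matrix ι₂ ι₂ ℂ) : Prop where
  posSemidef : σ.PosSemidef
  trace₂_eq : trace₂ σ = ρ₁
  trace₁_eq : trace₁ σ = ρ₂

/-- `σ` is a partial coupling of the partial density operators `ρ₁` and `ρ₂`.  If
`ρ₁` and `ρ₂` have trace one, then this says that `σ` is a coupling. -/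
structure IsPartialCoupling (σ : Matrix (ι₁ × ι₂) (ι₁ × ι₂) ℂ)
    (ρ₁ : Matrix ι₁ ι₁ ℂ) (ρ₂ : Matrix ι₂ ι₂ ℂ) : Prop where
  posSemidef : σ.PosSemidef
  trace₂_le : (ρ₁ - trace₂ σ).PosSemidef
  trace₁_le : (ρ₂ - trace₁ σ).PosSemidef
  trace_le : ρ₁.trace.re + ρ₂.trace.re ≤ 1 + σ.trace.re

/-- The split predicate `φ₁ ⊗ id + id ⊗ φ₂` of two positive operators. -/
def split (φ₁ : {P : Matrix ι₁ ι₁ ℂ // P.PosSemidef}) (φ₂ : {P : Matrix ι₂ ι₂ ℂ // P.PosSemidef}) :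
    InfPred (ι₁ × ι₂) :=
  InfPred.ofPos (φ₁.1 ⊗ₖ (1 : Matrix ι₂ ι₂ ℂ) + (1 : Matrix ι₁ ι₁ ℂ) ⊗ₖ φ₂.1)
    ((φ₁.2.kronecker Matrix.PosSemidef.one).add (Matrix.PosSemidef.one.kronecker φ₂.2))

/-- The duality set of `φ`: the triples `(n, φ₁, φ₂)` of a natural number and two positive
operators with `φ₁ ⊗ id + id ⊗ φ₂ ⊑ φ + n • id`. -/
def dualitySet (φ : InfPred (ι₁ × ι₂)) :
    Set (ℕ × {P : Matrix ι₁ ι₁ ℂ // P.PosSemidef} × {P : Matrix ι₂ ι₂ ℂ // P.PosSemidef}) :=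
  {y | split y.2.1 y.2.2 ≤ φ + InfPred.natId y.1}

/-- The measurement condition `K₁ ≈ K₂ : ψ ⇒ φ` for two measurements with the same outcomes:
if `ψ` has finite expectation in a joint state, then the post-measurement states can be coupled
for each common outcome `m`, such that the expectation of `ψ` bounds the total
expectation of the predicates `φ m`. -/
def MeasCond {n : ℕ} (K₁ : Fin n → Matrix ι₁ ι₁ ℂ) (K₂ : Fin n → Matrix ι₂ ι₂ ℂ)
    (ψ : InfPred (ι₁ × ι₂)) (φ : Fin n → InfPred (ι₁ × ι₂)) : Prop :=
  ∀ ρ : Matrix (ι₁ × ι₂) (ι₁ × ι₂) ℂ, ρ.PosSemidef → ρ.trace.re ≤ 1 → ψ.expect ρ ≠ ⊤ →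
    ∃ σ : Fin n → Matrix (ι₁ × ι₂) (ι₁ × ι₂) ℂ,
      (∀ m, IsCoupling (σ m) (K₁ m * trace₂ ρ * (K₁ m)ᴴ) (K₂ m * trace₁ ρ * (K₂ m)ᴴ)) ∧
      ∑ m, (φ m).expect (σ m) ≤ ψ.expect ρ

end Couplings

/-! ### The logic -/

section Logic

variable {V₁ V₂ : Type*} [Fintype V₁] [DecidableEq V₁] [Fintype V₂] [DecidableEq V₂]
  {d₁ : V₁ → ℕ} {d₂ : V₂ → ℕ}

/-- Relational assertions: infinite-valued predicates on the joint state space. -/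
abbrev RelAssn (d₁ : V₁ → ℕ) (d₂ : V₂ → ℕ) : Type _ := InfPred (Basis d₁ × Basis d₂)

/-- Validity of `{ψ} c₁ ~ c₂ {φ}`: for every joint density operator there is a partial
coupling of the two outputs in which the expectation of `φ` is at most that of `ψ` in the
input. -/
def Valid (ψ : RelAssn d₁ d₂) (c₁ : Prog d₁) (c₂ : Prog d₂) (φ : RelAssn d₁ d₂) : Prop :=
  ∀ ρ : Matrix (Basis d₁ × Basis d₂) (Basis d₁ × Basis d₂) ℂ, ρ.PosSemidef → ρ.trace = 1 →
    ∃ σ, IsPartialCoupling σ (c₁.sem (trace₂ ρ)) (c₂.sem (trace₁ ρ)) ∧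
      φ.expect σ ≤ ψ.expect ρ

/-- Validity of `{ψ} c₁ ~ c₂ {φ}` with couplings in place of partial couplings: for every
joint partial density operator there is a coupling of the two outputs in which the expectation
of `φ` is at most that of `ψ` in the input. -/
def ValidCoupling (ψ : RelAssn d₁ d₂) (c₁ : Prog d₁) (c₂ : Prog d₂) (φ : RelAssn d₁ d₂) :
    Prop :=
  ∀ ρ : Matrix (Basis d₁ × Basis d₂) (Basis d₁ × Basis d₂) ℂ, ρ.PosSemidef → ρ.trace.re ≤ 1 →
    ∃ σ, IsCoupling σ (c₁.sem (trace₂ ρ)) (c₂.sem (trace₁ ρ)) ∧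
      φ.expect σ ≤ ψ.expect ρ

/-- An operator on the left system, on the joint system. -/
def onL (K : Matrix (Basis d₁) (Basis d₁) ℂ) :
    Matrix (Basis d₁ × Basis d₂) (Basis d₁ × Basis d₂) ℂ :=
  K ⊗ₖ (1 : Matrix (Basis d₂) (Basis d₂) ℂ)

/-- An operator on the right system, on the joint system. -/
def onR (K : Matrix (Basis d₂) (Basis d₂) ℂ) :
    Matrix (Basis d₁ × Basis d₂) (Basis d₁ × Basis d₂) ℂ :=
  (1 : Matrix (Basis d₁) (Basis d₁) ℂ) ⊗ₖ K

/-- Derivability of `{ψ} c₁ ~ c₂ {φ}` in qOTL extended with the rule `unboundedDuality`. -/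
inductive Derivable : RelAssn d₁ d₂ → Prog d₁ → Prog d₂ → RelAssn d₁ d₂ → Prop
  /- two-sided rules -/
  | skip (ψ : RelAssn d₁ d₂) : Derivable ψ .skip .skip ψ
  | init (Q₁ w₁ h₁ Q₂ w₂ h₂) (ψ : RelAssn d₁ d₂) :
      Derivable
        (InfPred.kraus (fun i : RegBasis d₁ Q₁ × RegBasis d₂ Q₂ =>
          initKraus Q₁ w₁ i.1 ⊗ₖ initKraus Q₂ w₂ i.2) fun _ => ψ)
        (.init Q₁ w₁ h₁) (.init Q₂ w₂ h₂) ψ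
  | apply (Q₁ U₁ Q₂ U₂) (ψ : RelAssn d₁ d₂) :
      Derivable (InfPred.kraus (fun _ : Unit => lift Q₁ U₁.1 ⊗ₖ lift Q₂ U₂.1) fun _ => ψ)
        (.apply Q₁ U₁) (.apply Q₂ U₂) ψ
  | seq {ψ ξ φ : RelAssn d₁ d₂} {c₁ c₁' c₂ c₂'} :
      Derivable ψ c₁ c₂ ξ → Derivable ξ c₁' c₂' φ →
      Derivable ψ (.seq c₁ c₁') (.seq c₂ c₂') φ
  | cond {n Q₁ Q₂} {M₁ : Measurement d₁ Q₁ n} {M₂ : Measurement d₂ Q₂ n} {S₁ S₂}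
      {ψ φ : RelAssn d₁ d₂} (ξ : Fin n → RelAssn d₁ d₂) :
      MeasCond M₁.lifted M₂.lifted ψ ξ →
      (∀ m, Derivable (ξ m) (S₁ m) (S₂ m) φ) →
      Derivable ψ (.cond Q₁ n M₁ S₁) (.cond Q₂ n M₂ S₂) φ
  | loop {Q₁ Q₂} {M₁ : Measurement d₁ Q₁ 2} {M₂ : Measurement d₂ Q₂ 2} {c₁ c₂}
      {ψ φ ξ : RelAssn d₁ d₂} :
      MeasCond M₁.lifted M₂.lifted ψ ![φ, ξ] →
      Derivable ξ c₁ c₂ ψ →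
      Derivable ψ (.loop Q₁ M₁ c₁) (.loop Q₂ M₂ c₂) φ
  /- one-sided rules, left -/
  | initL (Q w h) (ψ : RelAssn d₁ d₂) :
      Derivable (InfPred.kraus (fun i : RegBasis d₁ Q => onL (initKraus Q w i)) fun _ => ψ)
        (.init Q w h) .skip ψ
  | applyL (Q U) (ψ : RelAssn d₁ d₂) :
      Derivable (InfPred.kraus (fun _ : Unit => onL (lift Q U.1)) fun _ => ψ)
        (.apply Q U) .skip ψ
  | condL {n Q} {M : Measurement d₁ Q n} {S c₂} {φ : RelAssn d₁ d₂} (ξ : Fin n → RelAssn d₁ d₂) :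
      (∀ m, Derivable (ξ m) (S m) c₂ φ) →
      Derivable (InfPred.kraus (fun m => onL (M.lifted m)) ξ) (.cond Q n M S) c₂ φ
  | loopL {Q} {M : Measurement d₁ Q 2} {c} {φ ξ : RelAssn d₁ d₂} :
      Derivable ξ c .skip (InfPred.kraus (fun m => onL (M.lifted m)) ![φ, ξ]) →
      Derivable (InfPred.kraus (fun m => onL (M.lifted m)) ![φ, ξ]) (.loop Q M c) .skip φ
  /- one-sided rules, right -/
  | initR (Q w h) (ψ : RelAssn d₁ d₂) :
      Derivable (InfPred.kraus (fun i : RegBasis d₂ Q => onR (initKraus Q w i)) fun _ => ψ)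
        .skip (.init Q w h) ψ
  | applyR (Q U) (ψ : RelAssn d₁ d₂) :
      Derivable (InfPred.kraus (fun _ : Unit => onR (lift Q U.1)) fun _ => ψ)
        .skip (.apply Q U) ψ
  | condR {n Q} {M : Measurement d₂ Q n} {S c₁} {φ : RelAssn d₁ d₂} (ξ : Fin n → RelAssn d₁ d₂) :
      (∀ m, Derivable (ξ m) c₁ (S m) φ) →
      Derivable (InfPred.kraus (fun m => onR (M.lifted m)) ξ) c₁ (.cond Q n M S) φ
  | loopR {Q} {M : Measurement d₂ Q 2} {c} {φ ξ : RelAssn d₁ d₂} :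
      Derivable ξ .skip c (InfPred.kraus (fun m => onR (M.lifted m)) ![φ, ξ]) →
      Derivable (InfPred.kraus (fun m => onR (M.lifted m)) ![φ, ξ]) .skip (.loop Q M c) φ
  /- structural rules -/
  | same {ψ φ : RelAssn d₁ d₂} {c₁ c₁' c₂ c₂'} :
      Prog.Same c₁ c₁' → Prog.Same c₂ c₂' → Derivable ψ c₁ c₂ φ → Derivable ψ c₁' c₂' φ
  | conseq {ψ ψ' φ φ' : RelAssn d₁ d₂} {c₁ c₂} :
      ψ' ≤ ψ → Derivable ψ' c₁ c₂ φ' → φ ≤ φ' → Derivable ψ c₁ c₂ φ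
  | boundedDuality {ψ φ : RelAssn d₁ d₂} {c₁ c₂} :
      c₁.AST → c₂.AST → φ.inf = 0 →
      (∀ y ∈ dualitySet φ, Derivable (ψ + InfPred.natId y.1) c₁ c₂ (split y.2.1 y.2.2)) →
      Derivable ψ c₁ c₂ φ
  | unboundedDuality {ψ φ : RelAssn d₁ d₂} {c₁ c₂} :
      c₁.AST → c₂.AST →
      (∀ y ∈ dualitySet φ, Derivable (ψ + InfPred.natId y.1) c₁ c₂ (split y.2.1 y.2.2)) →
      Derivable ψ c₁ c₂ φ

end Logic

end QOTL

end

/-!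
Interpreting every rule as a statement about maps of operators, soundness reduces to combining
partial couplings. These are made homogeneous by recording the mass of the input, so that they can
be added; a loop is the limit of its unrollings, and couplings pass to the limit by compactness.

The duality rule is sound by strong duality for couplings. When `φ` is truncated at `k`, the
Hahn–Banach theorem produces either a coupling or Hermitian potentials `H₁ ⊗ id + id ⊗ H₂ ⊑ φ` that
violate the bound; adding a multiple of the identity makes the potentials positive, which is where
the term `n • id` comes from. The limit `k → ∞` is again taken by compactness.

For completeness, the duality rule reduces the claim to postconditions `φ₁ ⊗ id + id ⊗ φ₂`. Their
weakest precondition `E₁†(φ₁) ⊗ id + id ⊗ E₂†(φ₂)` is derivable by one-sided rules, and validity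
says that it lies below `ψ + n • id`.
-/

namespace QOTL

/-! ### Positive semidefinite matrices -/

section PosSemidef

variable {ι : Type*} [Fintype ι]

open scoped MatrixOrder in
theorem exists_eq_conjTranspose_mul_self {A : Matrix ι ι ℂ} (hA : A.PosSemidef) :
    ∃ B : Matrix ι ι ℂ, A = Bᴴ * B := by
  classical exact CStarAlgebra.nonneg_iff_eq_star_mul_self.mp hA.nonneg

theorem trace_mul_nonneg {A B : Matrix ι ι ℂ} (hA : A.PosSemidef) (hB : B.PosSemidef) :
    0 ≤ (A * B).trace := by
  obtain ⟨a, rfl⟩ := exists_eq_conjTranspose_mul_self hA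
  rw [mul_assoc, Matrix.trace_mul_comm]
  exact (hB.mul_mul_conjTranspose_same a).trace_nonneg

theorem trace_mul_re_nonneg {A B : Matrix ι ι ℂ} (hA : A.PosSemidef) (hB : B.PosSemidef) :
    0 ≤ (A * B).trace.re :=
  (Complex.nonneg_iff.1 (trace_mul_nonneg hA hB)).1

theorem trace_re_nonneg {A : Matrix ι ι ℂ} (hA : A.PosSemidef) : 0 ≤ A.trace.re :=
  (Complex.nonneg_iff.1 hA.trace_nonneg).1

theorem trace_eq_re {A : Matrix ι ι ℂ} (hA : A.PosSemidef) : A.trace = A.trace.re :=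
  Complex.eq_re_of_ofReal_le (r := 0) (by simpa using hA.trace_nonneg)

theorem eq_zero_of_trace_re_eq_zero {A : Matrix ι ι ℂ} (hA : A.PosSemidef)
    (h : A.trace.re = 0) : A = 0 := by
  rw [← hA.trace_eq_zero_iff, trace_eq_re hA, h, Complex.ofReal_zero]

theorem mul_eq_zero_of_trace_re_eq_zero {A B : Matrix ι ι ℂ} (hA : A.PosSemidef)
    (hB : B.PosSemidef) (h : (A * B).trace.re = 0) : A * B = 0 := by
  obtain ⟨a, rfl⟩ := exists_eq_conjTranspose_mul_self hA
  obtain ⟨b, rfl⟩ := exists_eq_conjTranspose_mul_self hB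
  have habs : (a * bᴴ) * (a * bᴴ)ᴴ = 0 := by
    refine eq_zero_of_trace_re_eq_zero (Matrix.posSemidef_self_mul_conjTranspose _) ?_
    rw [← h, Matrix.conjTranspose_mul, Matrix.conjTranspose_conjTranspose, mul_assoc aᴴ,
      Matrix.trace_mul_comm aᴴ]
    simp only [mul_assoc]
  calc aᴴ * a * (bᴴ * b) = aᴴ * (a * bᴴ) * b := by simp only [mul_assoc]
    _ = 0 := by rw [Matrix.self_mul_conjTranspose_eq_zero.1 habs, mul_zero, zero_mul]

theorem trace_ofReal_smul_re (A : Matrix ι ι ℂ) (c : ℝ) :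
    ((c : ℂ) • A).trace.re = c * A.trace.re := by
  rw [Matrix.trace_smul, smul_eq_mul, Complex.re_ofReal_mul]

theorem trace_mul_conjTranspose_mul_mul (K X ρ : Matrix ι ι ℂ) :
    (Kᴴ * X * K * ρ).trace = (X * (K * ρ * Kᴴ)).trace := by
  rw [mul_assoc, mul_assoc, Matrix.trace_mul_comm, mul_assoc]

theorem posSemidef_of_isHermitian_of_mul_self_eq {X : Matrix ι ι ℂ} (h : X.IsHermitian)
    (h' : X * X = X) : X.PosSemidef := by
  simpa only [h.eq, h'] using Matrix.posSemidef_conjTranspose_mul_self X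

theorem posSemidef_of_trace_mul_re_nonneg {A : Matrix ι ι ℂ} (hA : A.IsHermitian)
    (h : ∀ ρ : Matrix ι ι ℂ, ρ.PosSemidef → 0 ≤ (A * ρ).trace.re) : A.PosSemidef := by
  refine Matrix.PosSemidef.of_dotProduct_mulVec_nonneg hA fun x => ?_
  have hx := h _ (Matrix.posSemidef_vecMulVec_self_star x)
  rw [Matrix.mul_vecMulVec, Matrix.trace_vecMulVec, dotProduct_comm] at hx
  exact Complex.nonneg_iff.2 ⟨hx, (hA.im_star_dotProduct_mulVec_self x).symm⟩

open scoped MatrixOrder Matrix.Norms.L2Operator in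
theorem span_posSemidef {ι : Type*} [Finite ι] :
    Submodule.span ℂ {A : Matrix ι ι ℂ | A.PosSemidef} = ⊤ := by
  classical
  have := Fintype.ofFinite ι
  simpa only [Matrix.nonneg_iff_posSemidef] using CStarAlgebra.span_nonneg (A := Matrix ι ι ℂ)

open scoped MatrixOrder Matrix.Norms.L2Operator in
theorem isClosed_setOf_posSemidef {ι : Type*} [Finite ι] :
    IsClosed {A : Matrix ι ι ℂ | A.PosSemidef} := by
  classical
  have := Fintype.ofFinite ι
  simpa only [Matrix.nonneg_iff_posSemidef] using CStarAlgebra.isClosed_nonneg (A := Matrix ι ι ℂ)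

theorem continuous_trace_re : Continuous fun A : Matrix ι ι ℂ => A.trace.re :=
  Complex.continuous_re.comp continuous_id.matrix_trace

open scoped Matrix.Norms.Frobenius in
theorem frobenius_norm_le_trace_re {A : Matrix ι ι ℂ} (hA : A.PosSemidef) :
    ‖A‖ ≤ A.trace.re := by
  classical
  obtain ⟨B, rfl⟩ := exists_eq_conjTranspose_mul_self hA
  have hB : (Bᴴ * B).trace.re = ‖B‖ ^ 2 := by
    simp only [Matrix.trace, Matrix.diag_apply, Matrix.mul_apply, Matrix.conjTranspose_apply,
      Complex.re_sum, RCLike.star_def, Complex.conj_mul', Matrix.frobenius_norm_def,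
      Real.rpow_ofNat, ← Real.sqrt_eq_rpow]
    rw [Real.sq_sqrt (by positivity), Finset.sum_comm]
    norm_cast
  calc ‖Bᴴ * B‖ ≤ ‖Bᴴ‖ * ‖B‖ := Matrix.frobenius_norm_mul _ _
    _ = (Bᴴ * B).trace.re := by rw [Matrix.frobenius_norm_conjTranspose, hB, sq]

open scoped Matrix.Norms.Frobenius in
theorem isCompact_setOf_posSemidef_trace_le (r : ℝ) :
    IsCompact {A : Matrix ι ι ℂ | A.PosSemidef ∧ A.trace.re ≤ r} := by
  have : ProperSpace (Matrix ι ι ℂ) := FiniteDimensional.proper ℂ _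
  refine (isCompact_closedBall (0 : Matrix ι ι ℂ) r).of_isClosed_subset
    (isClosed_setOf_posSemidef.inter (isClosed_le continuous_trace_re continuous_const)) ?_
  rintro A ⟨hA, hr⟩
  exact mem_closedBall_zero_iff.2 ((frobenius_norm_le_trace_re hA).trans hr)

end PosSemidef

/-! ### Expectations -/

section Expect

variable {ι : Type*} [Fintype ι]

/-- The expectation of the formal predicate `P + ∞ • S` in `ρ`, for positive operators `P` and `S`
that need not be orthogonal. In contrast to `InfPred.expect` it is visibly additive in
`P`, `S` and `ρ`. -/
noncomputable def formalExpect (P S ρ : Matrix ι ι ℂ) : ℝ≥0∞ :=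
  ENNReal.ofReal (P * ρ).trace.re + ⊤ * ENNReal.ofReal (S * ρ).trace.re

theorem formalExpect_of_mul_eq_zero (P : Matrix ι ι ℂ) {S ρ : Matrix ι ι ℂ} (h : S * ρ = 0) :
    formalExpect P S ρ = ENNReal.ofReal (P * ρ).trace.re := by
  simp [formalExpect, h]

theorem formalExpect_of_mul_ne_zero (P : Matrix ι ι ℂ) {S ρ : Matrix ι ι ℂ} (hS : S.PosSemidef)
    (hρ : ρ.PosSemidef) (h : S * ρ ≠ 0) : formalExpect P S ρ = ⊤ := by
  have hpos : 0 < (S * ρ).trace.re := (trace_mul_re_nonneg hS hρ).lt_of_ne'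
    fun h0 => h (mul_eq_zero_of_trace_re_eq_zero hS hρ h0)
  simp [formalExpect, ENNReal.top_mul, hpos]

theorem formalExpect_add {P S ρ σ : Matrix ι ι ℂ} (hP : P.PosSemidef) (hS : S.PosSemidef)
    (hρ : ρ.PosSemidef) (hσ : σ.PosSemidef) :
    formalExpect P S (ρ + σ) = formalExpect P S ρ + formalExpect P S σ := by
  simp only [formalExpect, mul_add, Matrix.trace_add, Complex.add_re]
  rw [ENNReal.ofReal_add (trace_mul_re_nonneg hP hρ) (trace_mul_re_nonneg hP hσ),
    ENNReal.ofReal_add (trace_mul_re_nonneg hS hρ) (trace_mul_re_nonneg hS hσ), mul_add]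
  abel

theorem add_formalExpect {P S Q T ρ : Matrix ι ι ℂ} (hP : P.PosSemidef) (hS : S.PosSemidef)
    (hQ : Q.PosSemidef) (hT : T.PosSemidef) (hρ : ρ.PosSemidef) :
    formalExpect (P + Q) (S + T) ρ = formalExpect P S ρ + formalExpect Q T ρ := by
  simp only [formalExpect, add_mul, Matrix.trace_add, Complex.add_re]
  rw [ENNReal.ofReal_add (trace_mul_re_nonneg hP hρ) (trace_mul_re_nonneg hQ hρ),
    ENNReal.ofReal_add (trace_mul_re_nonneg hS hρ) (trace_mul_re_nonneg hT hρ), mul_add]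
  abel

theorem formalExpect_kraus {κ : Type*} [Fintype κ] (K : κ → Matrix ι ι ℂ)
    {P S : κ → Matrix ι ι ℂ} (hP : ∀ k, (P k).PosSemidef) (hS : ∀ k, (S k).PosSemidef)
    {ρ : Matrix ι ι ℂ} (hρ : ρ.PosSemidef) :
    formalExpect (∑ k, (K k)ᴴ * P k * K k) (∑ k, (K k)ᴴ * S k * K k) ρ =
      ∑ k, formalExpect (P k) (S k) (K k * ρ * (K k)ᴴ) := by
  have hK : ∀ k, (K k * ρ * (K k)ᴴ).PosSemidef := fun k => hρ.mul_mul_conjTranspose_same _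
  simp only [formalExpect, Finset.sum_mul, Matrix.trace_sum, Complex.re_sum,
    trace_mul_conjTranspose_mul_mul, Finset.sum_add_distrib]
  rw [ENNReal.ofReal_sum_of_nonneg fun k _ => trace_mul_re_nonneg (hP k) (hK k),
    ENNReal.ofReal_sum_of_nonneg fun k _ => trace_mul_re_nonneg (hS k) (hK k), Finset.mul_sum]

theorem formalExpect_smul (P S ρ : Matrix ι ι ℂ) {c : ℝ} (hc : 0 ≤ c) :
    formalExpect P S ((c : ℂ) • ρ) = ENNReal.ofReal c * formalExpect P S ρ := by
  simp only [formalExpect, mul_smul_comm, trace_ofReal_smul_re, ENNReal.ofReal_mul hc]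
  ring

theorem exists_eq_sum_vecMulVec {ρ : Matrix ι ι ℂ} (hρ : ρ.PosSemidef) :
    ∃ v : ι → ι → ℂ, ρ = ∑ k, Matrix.vecMulVec (v k) (star (v k)) := by
  obtain ⟨B, rfl⟩ := exists_eq_conjTranspose_mul_self hρ
  refine ⟨fun k i => star (B k i), ?_⟩
  ext i j
  simp [Matrix.mul_apply, Matrix.sum_apply, Matrix.vecMulVec_apply]

variable [DecidableEq ι]

theorem suppProj_mul_eq_zero_iff {S : Matrix ι ι ℂ} (hS : S.IsHermitian) (ρ : Matrix ι ι ℂ) :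
    suppProj S * ρ = 0 ↔ S * ρ = 0 := by
  have hcont : ∀ f : ℝ → ℝ, ContinuousOn f (spectrum ℝ S) := fun f =>
    (Matrix.finite_real_spectrum (A := S)).continuousOn f
  have hcfc : ∀ f g : ℝ → ℝ, cfc f S * cfc g S = cfc (fun x => f x * g x) S := fun f g =>
    (cfc_mul f g S (hcont f) (hcont g)).symm
  have hid : cfc (fun x : ℝ => x) S = S := cfc_id' ℝ S hS
  have hmul : S * suppProj S = S :=
    calc S * suppProj S = cfc (fun x : ℝ => x) S * suppProj S := by rw [hid]
      _ = cfc (fun x : ℝ => x) S := by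
        rw [suppProj, hcfc]
        exact cfc_congr fun x _ => by simp +contextual
      _ = S := hid
  have hinv : cfc (fun x : ℝ => x⁻¹) S * S = suppProj S :=
    calc cfc (fun x : ℝ => x⁻¹) S * S = cfc (fun x : ℝ => x⁻¹) S * cfc (fun x : ℝ => x) S := by
          rw [hid]
      _ = suppProj S := by
        rw [suppProj, hcfc]
        exact cfc_congr fun x _ => by by_cases hx : x = 0 <;> simp [hx]
  constructor <;> intro h
  · rw [← hmul, mul_assoc, h, mul_zero]
  · rw [← hinv, mul_assoc, h, mul_zero]

namespace InfPred

theorem inf_posSemidef (A : InfPred ι) : A.inf.PosSemidef :=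
  posSemidef_of_isHermitian_of_mul_self_eq A.inf_isHermitian A.inf_mul_inf

theorem expect_eq_formalExpect (A : InfPred ι) {ρ : Matrix ι ι ℂ} (hρ : ρ.PosSemidef) :
    A.expect ρ = formalExpect A.fin A.inf ρ := by
  rw [expect]
  split_ifs with h
  · exact (formalExpect_of_mul_eq_zero _ h).symm
  · exact (formalExpect_of_mul_ne_zero _ A.inf_posSemidef hρ h).symm

theorem expect_ofParts {P S : Matrix ι ι ℂ} (hP : P.PosSemidef) (hS : S.PosSemidef)
    {ρ : Matrix ι ι ℂ} (hρ : ρ.PosSemidef) : (ofParts P S hP).expect ρ = formalExpect P S ρ := by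
  simp only [expect, ofParts, suppProj_mul_eq_zero_iff hS.1]
  split_ifs with h
  · have hsupp : suppProj S * ρ = 0 := (suppProj_mul_eq_zero_iff hS.1 ρ).2 h
    have hleft : (1 - suppProj S) * ρ = ρ := by rw [sub_mul, hsupp, one_mul, sub_zero]
    have hright : ρ * (1 - suppProj S) = ρ := by
      simpa only [Matrix.conjTranspose_mul, Matrix.conjTranspose_sub, Matrix.conjTranspose_one,
        (suppProj_isHermitian S).eq, hρ.1.eq] using congrArg Matrix.conjTranspose hleft
    rw [formalExpect_of_mul_eq_zero _ h, mul_assoc, hleft, mul_assoc, Matrix.trace_mul_comm,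
      mul_assoc, hright]
  · exact (formalExpect_of_mul_ne_zero _ hS hρ h).symm

theorem expect_ofPos {P : Matrix ι ι ℂ} (hP : P.PosSemidef) (ρ : Matrix ι ι ℂ) :
    (ofPos P hP).expect ρ = ENNReal.ofReal (P * ρ).trace.re := by
  simp [expect, ofPos]

theorem expect_natId (n : ℕ) (ρ : Matrix ι ι ℂ) :
    (natId n).expect ρ = ENNReal.ofReal (n * ρ.trace.re) := by
  simp [natId, expect_ofPos]

theorem expect_add_state (A : InfPred ι) {ρ σ : Matrix ι ι ℂ} (hρ : ρ.PosSemidef)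
    (hσ : σ.PosSemidef) : A.expect (ρ + σ) = A.expect ρ + A.expect σ := by
  rw [A.expect_eq_formalExpect hρ, A.expect_eq_formalExpect hσ,
    A.expect_eq_formalExpect (hρ.add hσ), formalExpect_add A.fin_posSemidef A.inf_posSemidef hρ hσ]

theorem expect_smul (A : InfPred ι) {ρ : Matrix ι ι ℂ} (hρ : ρ.PosSemidef) {c : ℝ}
    (hc : 0 ≤ c) : A.expect ((c : ℂ) • ρ) = ENNReal.ofReal c * A.expect ρ := by
  rw [A.expect_eq_formalExpect hρ,
    A.expect_eq_formalExpect (hρ.smul (Complex.zero_le_real.2 hc)), formalExpect_smul _ _ _ hc]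

@[simp]
theorem expect_zero (A : InfPred ι) : A.expect 0 = 0 := by simp [expect]

theorem expect_sum (A : InfPred ι) {κ : Type*} (s : Finset κ) {ρ : κ → Matrix ι ι ℂ}
    (hρ : ∀ k, (ρ k).PosSemidef) : A.expect (∑ k ∈ s, ρ k) = ∑ k ∈ s, A.expect (ρ k) := by
  classical
  induction s using Finset.induction_on with
  | empty => simp
  | insert a s ha ih =>
    rw [Finset.sum_insert ha, Finset.sum_insert ha, A.expect_add_state (hρ a)
      (Matrix.posSemidef_sum _ fun k _ => hρ k), ih]

theorem expect_add (A B : InfPred ι) {ρ : Matrix ι ι ℂ} (hρ : ρ.PosSemidef) :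
    (A + B).expect ρ = A.expect ρ + B.expect ρ := by
  rw [A.expect_eq_formalExpect hρ, B.expect_eq_formalExpect hρ,
    ← add_formalExpect A.fin_posSemidef A.inf_posSemidef B.fin_posSemidef B.inf_posSemidef hρ]
  exact expect_ofParts _ (A.inf_posSemidef.add B.inf_posSemidef) hρ

theorem expect_kraus {κ : Type*} [Fintype κ] (K : κ → Matrix ι ι ℂ) (A : κ → InfPred ι)
    {ρ : Matrix ι ι ℂ} (hρ : ρ.PosSemidef) :
    (kraus K A).expect ρ = ∑ k, (A k).expect (K k * ρ * (K k)ᴴ) := by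
  simp only [fun k => (A k).expect_eq_formalExpect (hρ.mul_mul_conjTranspose_same (K k))]
  rw [← formalExpect_kraus K (fun k => (A k).fin_posSemidef) (fun k => (A k).inf_posSemidef) hρ]
  exact expect_ofParts _ (Matrix.posSemidef_sum _ fun k _ =>
    (A k).inf_posSemidef.conjTranspose_mul_mul_same (K k)) hρ

theorem le_iff_expect_le {A B : InfPred ι} :
    A ≤ B ↔ ∀ ρ : Matrix ι ι ℂ, ρ.PosSemidef → A.expect ρ ≤ B.expect ρ := by
  refine ⟨fun h ρ hρ => ?_, fun h v => h _ (Matrix.posSemidef_vecMulVec_self_star v)⟩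
  obtain ⟨v, rfl⟩ := exists_eq_sum_vecMulVec hρ
  have hv := fun k => Matrix.posSemidef_vecMulVec_self_star (v k)
  rw [A.expect_sum _ hv, B.expect_sum _ hv]
  exact Finset.sum_le_sum fun k _ => h (v k)

theorem isClosed_setOf_expect_le (A : InfPred ι) (t : ℝ≥0∞) :
    IsClosed {σ : Matrix ι ι ℂ | A.expect σ ≤ t} := by
  rcases eq_or_ne t ⊤ with rfl | ht
  · simp
  have hset : {σ : Matrix ι ι ℂ | A.expect σ ≤ t} =
      {σ | A.inf * σ = 0} ∩ {σ | (A.fin * σ).trace.re ≤ t.toReal} := by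
    ext σ
    by_cases h : A.inf * σ = 0 <;> simp [expect, h, ht, ENNReal.ofReal_le_iff_le_toReal]
  rw [hset]
  refine (isClosed_eq ?_ continuous_const).inter (isClosed_le ?_ continuous_const) <;> fun_prop

end InfPred

end Expect

theorem map_sum_of_isLinearMap {R M N κ : Type*} [Semiring R] [AddCommMonoid M] [AddCommMonoid N]
    [Module R M] [Module R N] {f : M → N} (hf : IsLinearMap R f) (s : Finset κ) (x : κ → M) :
    f (∑ k ∈ s, x k) = ∑ k ∈ s, f (x k) :=
  map_sum (IsLinearMap.mk' f hf) x s

/-! ### Partial traces -/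

section PartialTrace

variable {ι₁ ι₂ : Type*}

theorem trace₁_eq_trace₂_submatrix_swap [Fintype ι₁] (σ : Matrix (ι₁ × ι₂) (ι₁ × ι₂) ℂ) :
    trace₁ σ = trace₂ (σ.submatrix Prod.swap Prod.swap) :=
  rfl

theorem kronecker_submatrix_swap (A : Matrix ι₁ ι₁ ℂ) (B : Matrix ι₂ ι₂ ℂ) :
    (A ⊗ₖ B).submatrix Prod.swap Prod.swap = B ⊗ₖ A := by
  ext
  simp [mul_comm]

theorem isLinearMap_trace₂ [Fintype ι₂] :
    IsLinearMap ℂ (trace₂ : Matrix (ι₁ × ι₂) (ι₁ × ι₂) ℂ → Matrix ι₁ ι₁ ℂ) where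
  map_add σ τ := by ext; simp [trace₂, Finset.sum_add_distrib]
  map_smul c σ := by ext; simp [trace₂, Finset.mul_sum]

theorem isLinearMap_trace₁ [Fintype ι₁] :
    IsLinearMap ℂ (trace₁ : Matrix (ι₁ × ι₂) (ι₁ × ι₂) ℂ → Matrix ι₂ ι₂ ℂ) where
  map_add σ τ := by ext; simp [trace₁, Finset.sum_add_distrib]
  map_smul c σ := by ext; simp [trace₁, Finset.mul_sum]

theorem posSemidef_trace₂ [Fintype ι₂] {σ : Matrix (ι₁ × ι₂) (ι₁ × ι₂) ℂ} (h : σ.PosSemidef) :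
    (trace₂ σ).PosSemidef := by
  have hsum : trace₂ σ = ∑ j, σ.submatrix (fun i => (i, j)) (fun i => (i, j)) := by
    ext
    simp [trace₂, Matrix.sum_apply]
  rw [hsum]
  exact Matrix.posSemidef_sum _ fun j _ => h.submatrix _

theorem posSemidef_trace₁ [Fintype ι₁] {σ : Matrix (ι₁ × ι₂) (ι₁ × ι₂) ℂ} (h : σ.PosSemidef) :
    (trace₁ σ).PosSemidef :=
  posSemidef_trace₂ (h.submatrix Prod.swap)

theorem continuous_trace₂ [Fintype ι₂] :
    Continuous (trace₂ : Matrix (ι₁ × ι₂) (ι₁ × ι₂) ℂ → Matrix ι₁ ι₁ ℂ) :=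
  continuous_matrix fun i j => by simp only [trace₂, Matrix.of_apply]; fun_prop

theorem continuous_trace₁ [Fintype ι₁] :
    Continuous (trace₁ : Matrix (ι₁ × ι₂) (ι₁ × ι₂) ℂ → Matrix ι₂ ι₂ ℂ) :=
  continuous_trace₂.comp (continuous_id.matrix_submatrix Prod.swap Prod.swap)

theorem trace₂_kronecker [Fintype ι₂] (A : Matrix ι₁ ι₁ ℂ) (B : Matrix ι₂ ι₂ ℂ) :
    trace₂ (A ⊗ₖ B) = B.trace • A := by
  ext
  simp [trace₂, Matrix.trace, ← Finset.mul_sum, mul_comm]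

theorem trace₁_kronecker [Fintype ι₁] (A : Matrix ι₁ ι₁ ℂ) (B : Matrix ι₂ ι₂ ℂ) :
    trace₁ (A ⊗ₖ B) = A.trace • B := by
  rw [trace₁_eq_trace₂_submatrix_swap, kronecker_submatrix_swap, trace₂_kronecker]

variable [Fintype ι₁] [Fintype ι₂]

@[simp]
theorem trace_trace₂ (σ : Matrix (ι₁ × ι₂) (ι₁ × ι₂) ℂ) : (trace₂ σ).trace = σ.trace := by
  simp [trace₂, Matrix.trace, Fintype.sum_prod_type]

@[simp]
theorem trace_trace₁ (σ : Matrix (ι₁ × ι₂) (ι₁ × ι₂) ℂ) : (trace₁ σ).trace = σ.trace := by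
  simp [trace₁, Matrix.trace, Fintype.sum_prod_type_right]

theorem trace_mul_trace₂ [DecidableEq ι₂] (A : Matrix ι₁ ι₁ ℂ)
    (σ : Matrix (ι₁ × ι₂) (ι₁ × ι₂) ℂ) :
    (A * trace₂ σ).trace = (A ⊗ₖ (1 : Matrix ι₂ ι₂ ℂ) * σ).trace := by
  simp only [Matrix.trace, Matrix.diag_apply, Matrix.mul_apply, trace₂, Matrix.of_apply,
    Fintype.sum_prod_type, Matrix.kronecker_apply, Matrix.one_apply, mul_ite, mul_one, mul_zero,
    ite_mul, zero_mul, Finset.sum_ite_eq, Finset.mem_univ, if_true, Finset.mul_sum]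
  exact Finset.sum_congr rfl fun i _ => Finset.sum_comm

theorem trace_mul_trace₁ [DecidableEq ι₁] (B : Matrix ι₂ ι₂ ℂ)
    (σ : Matrix (ι₁ × ι₂) (ι₁ × ι₂) ℂ) :
    (B * trace₁ σ).trace = ((1 : Matrix ι₁ ι₁ ℂ) ⊗ₖ B * σ).trace := by
  have hswap : B ⊗ₖ (1 : Matrix ι₁ ι₁ ℂ) * σ.submatrix Prod.swap Prod.swap =
      ((1 : Matrix ι₁ ι₁ ℂ) ⊗ₖ B * σ).submatrix Prod.swap Prod.swap := by
    rw [← kronecker_submatrix_swap]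
    exact Matrix.submatrix_mul_equiv _ _ _ (Equiv.prodComm ι₂ ι₁) _
  rw [trace₁_eq_trace₂_submatrix_swap, trace_mul_trace₂, hswap]
  exact Equiv.sum_comp (Equiv.prodComm ι₂ ι₁)
    fun x => ((1 : Matrix ι₁ ι₁ ℂ) ⊗ₖ B * σ) x x

theorem sum_trace₂_kronecker_conj [DecidableEq ι₂] {κ : Type*} [Fintype κ]
    {L : κ → Matrix ι₂ ι₂ ℂ} (hL : ∑ k, (L k)ᴴ * L k = 1) (K : Matrix ι₁ ι₁ ℂ)
    (σ : Matrix (ι₁ × ι₂) (ι₁ × ι₂) ℂ) :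
    ∑ k, trace₂ ((K ⊗ₖ L k) * σ * (K ⊗ₖ L k)ᴴ) = K * trace₂ σ * Kᴴ := by
  refine Matrix.ext_iff_trace_mul_left.2 fun A => ?_
  have hterm : ∀ k, (A * trace₂ ((K ⊗ₖ L k) * σ * (K ⊗ₖ L k)ᴴ)).trace =
      ((Kᴴ * A * K) ⊗ₖ ((L k)ᴴ * L k) * σ).trace := fun k => by
    rw [trace_mul_trace₂, ← trace_mul_conjTranspose_mul_mul, Matrix.conjTranspose_kronecker,
      ← Matrix.mul_kronecker_mul, ← Matrix.mul_kronecker_mul, mul_one]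
  have hsum : ∑ k, (Kᴴ * A * K) ⊗ₖ ((L k)ᴴ * L k) = (Kᴴ * A * K) ⊗ₖ (1 : Matrix ι₂ ι₂ ℂ) := by
    rw [← hL]
    exact (map_sum (Matrix.kroneckerBilinear (R := ℂ) (Kᴴ * A * K) :
      Matrix ι₂ ι₂ ℂ →ₗ[ℂ] Matrix (ι₁ × ι₂) (ι₁ × ι₂) ℂ) _ _).symm
  rw [Finset.mul_sum, Matrix.trace_sum, ← trace_mul_conjTranspose_mul_mul, trace_mul_trace₂, ← hsum,
    Finset.sum_mul, Matrix.trace_sum]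
  exact Finset.sum_congr rfl fun k _ => hterm k

theorem sum_trace₁_kronecker_conj [DecidableEq ι₁] {κ : Type*} [Fintype κ]
    {K : κ → Matrix ι₁ ι₁ ℂ} (hK : ∑ k, (K k)ᴴ * K k = 1) (L : Matrix ι₂ ι₂ ℂ)
    (σ : Matrix (ι₁ × ι₂) (ι₁ × ι₂) ℂ) :
    ∑ k, trace₁ ((K k ⊗ₖ L) * σ * (K k ⊗ₖ L)ᴴ) = L * trace₁ σ * Lᴴ := by
  rw [trace₁_eq_trace₂_submatrix_swap, ← sum_trace₂_kronecker_conj hK]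
  refine Finset.sum_congr rfl fun k _ => ?_
  rw [trace₁_eq_trace₂_submatrix_swap, ← kronecker_submatrix_swap (K k) L,
    Matrix.conjTranspose_submatrix, ← Equiv.coe_prodComm, Matrix.submatrix_mul_equiv,
    Matrix.submatrix_mul_equiv]

theorem trace_split_mul [DecidableEq ι₁] [DecidableEq ι₂] (P : Matrix ι₁ ι₁ ℂ)
    (R : Matrix ι₂ ι₂ ℂ) (σ : Matrix (ι₁ × ι₂) (ι₁ × ι₂) ℂ) :
    ((P ⊗ₖ (1 : Matrix ι₂ ι₂ ℂ) + (1 : Matrix ι₁ ι₁ ℂ) ⊗ₖ R) * σ).trace =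
      (P * trace₂ σ).trace + (R * trace₁ σ).trace := by
  rw [add_mul, Matrix.trace_add, trace_mul_trace₂, trace_mul_trace₁]

theorem expect_split [DecidableEq ι₁] [DecidableEq ι₂] (P : {P : Matrix ι₁ ι₁ ℂ // P.PosSemidef})
    (R : {R : Matrix ι₂ ι₂ ℂ // R.PosSemidef}) (σ : Matrix (ι₁ × ι₂) (ι₁ × ι₂) ℂ) :
    (split P R).expect σ =
      ENNReal.ofReal ((P.1 * trace₂ σ).trace.re + (R.1 * trace₁ σ).trace.re) := by
  rw [split, InfPred.expect_ofPos, trace_split_mul, Complex.add_re]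

end PartialTrace

/-! ### Quantum operations -/

section QuantumOp

variable {ι : Type*} [Fintype ι]

/-- A quantum operation, weakened from complete positivity to positivity: a linear, positive and
trace-nonincreasing map of operators. -/
structure IsQuantumOp (E : Matrix ι ι ℂ → Matrix ι ι ℂ) : Prop where
  isLinearMap : IsLinearMap ℂ E
  posSemidef : ∀ {ρ}, ρ.PosSemidef → (E ρ).PosSemidef
  trace_le : ∀ {ρ}, ρ.PosSemidef → (E ρ).trace.re ≤ ρ.trace.re

/-- The matrix representing the linear functional `g` through the trace pairing. -/
def traceDual [DecidableEq ι] (g : Matrix ι ι ℂ →ₗ[ℂ] ℂ) : Matrix ι ι ℂ :=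
  Matrix.of fun j i => g (Matrix.single i j 1)

theorem trace_traceDual_mul [DecidableEq ι] (g : Matrix ι ι ℂ →ₗ[ℂ] ℂ) (X : Matrix ι ι ℂ) :
    (traceDual g * X).trace = g X := by
  have hsingle : ∀ i j, Matrix.single i j (X i j) = X i j • Matrix.single i j (1 : ℂ) := by simp
  conv_rhs => rw [Matrix.matrix_eq_sum_single X]
  simp only [hsingle, map_sum, map_smul, smul_eq_mul, Matrix.trace, Matrix.diag_apply,
    Matrix.mul_apply, traceDual, Matrix.of_apply]
  rw [Finset.sum_comm]
  simp only [mul_comm]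

theorem sum_trace_kraus [DecidableEq ι] {κ : Type*} [Fintype κ] {K : κ → Matrix ι ι ℂ}
    (hK : ∑ k, (K k)ᴴ * K k = 1) (ρ : Matrix ι ι ℂ) :
    ∑ k, (K k * ρ * (K k)ᴴ).trace = ρ.trace := by
  have hterm : ∀ k, (K k * ρ * (K k)ᴴ).trace = ((K k)ᴴ * K k * ρ).trace := fun k => by
    rw [Matrix.trace_mul_comm, ← mul_assoc]
  rw [Finset.sum_congr rfl fun k _ => hterm k, ← Matrix.trace_sum, ← Finset.sum_mul, hK, one_mul]

namespace IsQuantumOp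

variable {E F : Matrix ι ι ℂ → Matrix ι ι ℂ}

theorem id : IsQuantumOp fun ρ : Matrix ι ι ℂ => ρ :=
  ⟨LinearMap.id.isLinear, fun h => h, fun _ => le_rfl⟩

theorem zero : IsQuantumOp fun _ : Matrix ι ι ℂ => 0 :=
  ⟨(0 : Matrix ι ι ℂ →ₗ[ℂ] Matrix ι ι ℂ).isLinear, fun _ => Matrix.PosSemidef.zero,
    fun h => by simpa using trace_re_nonneg h⟩

theorem comp (hF : IsQuantumOp F) (hE : IsQuantumOp E) : IsQuantumOp fun ρ => F (E ρ) where
  isLinearMap := (hF.isLinearMap.mk'.comp hE.isLinearMap.mk').isLinear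
  posSemidef h := hF.posSemidef (hE.posSemidef h)
  trace_le h := (hF.trace_le (hE.posSemidef h)).trans (hE.trace_le h)

theorem map_conjTranspose (hE : IsQuantumOp E) (ρ : Matrix ι ι ℂ) : E ρᴴ = (E ρ)ᴴ := by
  have hρ : ρ ∈ Submodule.span ℂ {A : Matrix ι ι ℂ | A.PosSemidef} := by
    rw [span_posSemidef]; exact Submodule.mem_top
  induction hρ using Submodule.span_induction with
  | mem ρ h => rw [(show ρ.PosSemidef from h).1.eq, (hE.posSemidef h).1.eq]
  | zero => simp [hE.isLinearMap.map_zero]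
  | add ρ σ _ _ hρ hσ =>
    simp only [Matrix.conjTranspose_add, hE.isLinearMap.map_add, hρ, hσ]
  | smul c ρ _ hρ => simp only [Matrix.conjTranspose_smul, hE.isLinearMap.map_smul, hρ]

/-- The Heisenberg dual `E†` of a quantum operation, defined by `tr (E†(P) ρ) = tr (P E(ρ))`. -/
def dual [DecidableEq ι] (hE : IsQuantumOp E) (P : Matrix ι ι ℂ) : Matrix ι ι ℂ :=
  traceDual (Matrix.traceLinearMap ι ℂ ℂ ∘ₗ LinearMap.mulLeft ℂ P ∘ₗ hE.isLinearMap.mk')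

variable [DecidableEq ι]

theorem trace_dual_mul (hE : IsQuantumOp E) (P ρ : Matrix ι ι ℂ) :
    (hE.dual P * ρ).trace = (P * E ρ).trace :=
  trace_traceDual_mul _ ρ

theorem posSemidef_dual (hE : IsQuantumOp E) {P : Matrix ι ι ℂ} (hP : P.PosSemidef) :
    (hE.dual P).PosSemidef := by
  refine posSemidef_of_trace_mul_re_nonneg (Matrix.ext_iff_trace_mul_right.2 fun ρ => ?_)
    fun ρ hρ => ?_
  · calc ((hE.dual P)ᴴ * ρ).trace = star (hE.dual P * ρᴴ).trace := by
          rw [← Matrix.trace_conjTranspose, Matrix.conjTranspose_mul,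
            Matrix.conjTranspose_conjTranspose, Matrix.trace_mul_comm]
      _ = star (P * (E ρ)ᴴ).trace := by rw [hE.trace_dual_mul, hE.map_conjTranspose]
      _ = (hE.dual P * ρ).trace := by
          rw [hE.trace_dual_mul, ← Matrix.trace_conjTranspose, Matrix.conjTranspose_mul,
            Matrix.conjTranspose_conjTranspose, hP.1.eq, Matrix.trace_mul_comm]
  · rw [hE.trace_dual_mul]
    exact trace_mul_re_nonneg hP (hE.posSemidef hρ)

end IsQuantumOp

/-- The operation `E` measures with the operators `K` and continues with `S k` after the
outcome `k`. -/
structure IsBranching [DecidableEq ι] {κ : Type*} [Fintype κ] (E : Matrix ι ι ℂ → Matrix ι ι ℂ)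
    (K : κ → Matrix ι ι ℂ) (S : κ → Matrix ι ι ℂ → Matrix ι ι ℂ) : Prop where
  complete : ∑ k, (K k)ᴴ * K k = 1
  isQuantumOp_branch : ∀ k, IsQuantumOp (S k)
  eq_sum : ∀ ρ, E ρ = ∑ k, S k (K k * ρ * (K k)ᴴ)

theorem IsBranching.isQuantumOp [DecidableEq ι] {κ : Type*} [Fintype κ]
    {E : Matrix ι ι ℂ → Matrix ι ι ℂ} {K : κ → Matrix ι ι ℂ}
    {S : κ → Matrix ι ι ℂ → Matrix ι ι ℂ} (h : IsBranching E K S) : IsQuantumOp E where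
  isLinearMap := IsLinearMap.mk
    (fun ρ σ => by
      simp only [h.eq_sum, mul_add, add_mul, (h.isQuantumOp_branch _).isLinearMap.map_add,
        Finset.sum_add_distrib])
    (fun c ρ => by
      simp only [h.eq_sum, mul_smul_comm, smul_mul_assoc,
        (h.isQuantumOp_branch _).isLinearMap.map_smul, Finset.smul_sum])
  posSemidef {ρ} hρ := by
    rw [h.eq_sum]
    exact Matrix.posSemidef_sum _ fun k _ =>
      (h.isQuantumOp_branch k).posSemidef (hρ.mul_mul_conjTranspose_same _)
  trace_le {ρ} hρ := by
    rw [h.eq_sum, ← sum_trace_kraus h.complete ρ, Matrix.trace_sum, Complex.re_sum, Complex.re_sum]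
    exact Finset.sum_le_sum fun k _ =>
      (h.isQuantumOp_branch k).trace_le (hρ.mul_mul_conjTranspose_same _)

theorem IsBranching.of_isQuantumOp [DecidableEq ι] {E : Matrix ι ι ℂ → Matrix ι ι ℂ}
    (hE : IsQuantumOp E) : IsBranching E (fun _ : Unit => 1) fun _ => E where
  complete := by simp
  isQuantumOp_branch _ := hE
  eq_sum ρ := by simp

theorem isQuantumOp_kraus_term [DecidableEq ι] {κ : Type*} [Fintype κ] {K : κ → Matrix ι ι ℂ}
    (hK : ∑ k, (K k)ᴴ * K k = 1) (k : κ) : IsQuantumOp fun ρ => K k * ρ * (K k)ᴴ := by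
  classical
  refine IsBranching.isQuantumOp (K := K) (S := fun l ρ => if l = k then ρ else 0)
    ⟨hK, fun l => ?_, by simp⟩
  by_cases h : l = k <;> simp only [h, if_true, if_false, IsQuantumOp.id, IsQuantumOp.zero]

end QuantumOp

/-! ### Loops and the semantics of programs -/

section Loop

variable {ι : Type*} [Fintype ι]

/-- The contribution to the output of a loop with measurement operators `K` and body `E` of the
runs that execute the body exactly `k` times. -/
def loopTerm (K : Fin 2 → Matrix ι ι ℂ) (E : Matrix ι ι ℂ → Matrix ι ι ℂ) (k : ℕ)
    (ρ : Matrix ι ι ℂ) : Matrix ι ι ℂ :=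
  K 0 * (fun τ => E (K 1 * τ * (K 1)ᴴ))^[k] ρ * (K 0)ᴴ

/-- The contribution to the output of a loop of the runs that execute the body fewer than `n`
times. -/
def loopApprox (K : Fin 2 → Matrix ι ι ℂ) (E : Matrix ι ι ℂ → Matrix ι ι ℂ) (n : ℕ)
    (ρ : Matrix ι ι ℂ) : Matrix ι ι ℂ :=
  ∑ k ∈ Finset.range n, loopTerm K E k ρ

/-- The semantics of a loop with measurement operators `K` and body `E`. -/
noncomputable def loopSem (K : Fin 2 → Matrix ι ι ℂ) (E : Matrix ι ι ℂ → Matrix ι ι ℂ)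
    (ρ : Matrix ι ι ℂ) : Matrix ι ι ℂ :=
  ∑' k, loopTerm K E k ρ

variable {K : Fin 2 → Matrix ι ι ℂ} {E : Matrix ι ι ℂ → Matrix ι ι ℂ}

theorem loopApprox_succ (n : ℕ) (ρ : Matrix ι ι ℂ) :
    loopApprox K E (n + 1) ρ =
      K 0 * ρ * (K 0)ᴴ + loopApprox K E n (E (K 1 * ρ * (K 1)ᴴ)) := by
  rw [loopApprox, Finset.sum_range_succ', add_comm]
  rfl

variable [DecidableEq ι]

theorem isQuantumOp_loopTerm (hE : IsQuantumOp E) (hK : ∑ m, (K m)ᴴ * K m = 1) (k : ℕ) :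
    IsQuantumOp (loopTerm K E k) := by
  induction k with
  | zero => exact isQuantumOp_kraus_term hK 0
  | succ k ih => exact ih.comp (hE.comp (isQuantumOp_kraus_term hK 1))

theorem isBranching_loopApprox_succ (hE : IsQuantumOp E) (hK : ∑ m, (K m)ᴴ * K m = 1) {n : ℕ}
    (hn : IsQuantumOp (loopApprox K E n)) :
    IsBranching (loopApprox K E (n + 1)) K ![fun ρ => ρ, fun ρ => loopApprox K E n (E ρ)] where
  complete := hK
  isQuantumOp_branch := Fin.forall_fin_two.2 ⟨.id, hn.comp hE⟩
  eq_sum ρ := by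
    rw [loopApprox_succ, Fin.sum_univ_two]
    rfl

theorem isQuantumOp_loopApprox (hE : IsQuantumOp E) (hK : ∑ m, (K m)ᴴ * K m = 1) (n : ℕ) :
    IsQuantumOp (loopApprox K E n) := by
  induction n with
  | zero => exact .zero
  | succ n ih => exact (isBranching_loopApprox_succ hE hK ih).isQuantumOp

open scoped Matrix.Norms.Frobenius in
theorem summable_loopTerm (hE : IsQuantumOp E) (hK : ∑ m, (K m)ᴴ * K m = 1)
    (ρ : Matrix ι ι ℂ) : Summable fun k => loopTerm K E k ρ := by
  have hterm := isQuantumOp_loopTerm hE hK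
  have hρ : ρ ∈ Submodule.span ℂ {A : Matrix ι ι ℂ | A.PosSemidef} := by
    rw [span_posSemidef]; exact Submodule.mem_top
  induction hρ using Submodule.span_induction with
  | mem ρ hρ =>
    have hpos : ∀ k, (loopTerm K E k ρ).PosSemidef := fun k => (hterm k).posSemidef hρ
    have hbound : ∀ n, ∑ k ∈ Finset.range n, (loopTerm K E k ρ).trace.re ≤ ρ.trace.re := fun n => by
      rw [← Complex.re_sum, ← Matrix.trace_sum]
      exact (isQuantumOp_loopApprox hE hK n).trace_le hρ
    exact .of_norm_bounded (summable_of_sum_range_le (fun k => trace_re_nonneg (hpos k)) hbound)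
      fun k => frobenius_norm_le_trace_re (hpos k)
  | zero => simpa only [(hterm _).isLinearMap.map_zero] using summable_zero
  | add ρ σ _ _ hρ hσ => simpa only [(hterm _).isLinearMap.map_add] using hρ.add hσ
  | smul c ρ _ hρ => simpa only [(hterm _).isLinearMap.map_smul] using hρ.const_smul c

theorem tendsto_loopApprox (hE : IsQuantumOp E) (hK : ∑ m, (K m)ᴴ * K m = 1)
    (ρ : Matrix ι ι ℂ) :
    Filter.Tendsto (fun n => loopApprox K E n ρ) Filter.atTop (nhds (loopSem K E ρ)) :=
  (summable_loopTerm hE hK ρ).hasSum.tendsto_sum_nat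

theorem isQuantumOp_loopSem (hE : IsQuantumOp E) (hK : ∑ m, (K m)ᴴ * K m = 1) :
    IsQuantumOp (loopSem K E) where
  isLinearMap := IsLinearMap.mk
    (fun ρ σ => by
      simp only [loopSem, (isQuantumOp_loopTerm hE hK _).isLinearMap.map_add]
      exact (summable_loopTerm hE hK ρ).tsum_add (summable_loopTerm hE hK σ))
    (fun c ρ => by
      simp only [loopSem, (isQuantumOp_loopTerm hE hK _).isLinearMap.map_smul]
      exact (summable_loopTerm hE hK ρ).tsum_const_smul c)
  posSemidef {ρ} hρ := isClosed_setOf_posSemidef.mem_of_tendsto (tendsto_loopApprox hE hK ρ)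
    (.of_forall fun n => (isQuantumOp_loopApprox hE hK n).posSemidef hρ)
  trace_le {ρ} hρ := le_of_tendsto
    ((continuous_trace_re.tendsto _).comp (tendsto_loopApprox hE hK ρ))
    (.of_forall fun n => (isQuantumOp_loopApprox hE hK n).trace_le hρ)

theorem loopSem_eq (hE : IsQuantumOp E) (hK : ∑ m, (K m)ᴴ * K m = 1) (ρ : Matrix ι ι ℂ) :
    loopSem K E ρ = K 0 * ρ * (K 0)ᴴ + loopSem K E (E (K 1 * ρ * (K 1)ᴴ)) :=
  (summable_loopTerm hE hK ρ).tsum_eq_zero_add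

theorem isBranching_loopSem (hE : IsQuantumOp E) (hK : ∑ m, (K m)ᴴ * K m = 1) :
    IsBranching (loopSem K E) K ![fun ρ => ρ, fun ρ => loopSem K E (E ρ)] where
  complete := hK
  isQuantumOp_branch := Fin.forall_fin_two.2 ⟨.id, (isQuantumOp_loopSem hE hK).comp hE⟩
  eq_sum ρ := by
    rw [loopSem_eq hE hK, Fin.sum_univ_two]
    rfl

end Loop

section Semantics

variable {V : Type*} [Fintype V] [DecidableEq V] {d : V → ℕ} {Q : Finset V}

theorem lift_eq_submatrix (A : Matrix (RegBasis d Q) (RegBasis d Q) ℂ) :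
    lift Q A = (A ⊗ₖ (1 : Matrix (∀ v : {v // v ∉ Q}, Fin (d v)) _ ℂ)).submatrix
      (Equiv.piEquivPiSubtypeProd (· ∈ Q) fun v => Fin (d v))
      (Equiv.piEquivPiSubtypeProd (· ∈ Q) fun v => Fin (d v)) := by
  ext
  simp [lift, Matrix.one_apply, funext_iff, Equiv.piEquivPiSubtypeProd]

theorem lift_mul (A B : Matrix (RegBasis d Q) (RegBasis d Q) ℂ) :
    lift Q (A * B) = lift Q A * lift Q B := by
  simp only [lift_eq_submatrix, Matrix.submatrix_mul_equiv, ← Matrix.mul_kronecker_mul, mul_one]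

theorem lift_conjTranspose (A : Matrix (RegBasis d Q) (RegBasis d Q) ℂ) :
    (lift Q A)ᴴ = lift Q Aᴴ := by
  simp only [lift_eq_submatrix, Matrix.conjTranspose_submatrix, Matrix.conjTranspose_kronecker,
    Matrix.conjTranspose_one]

theorem lift_one : lift Q (1 : Matrix (RegBasis d Q) (RegBasis d Q) ℂ) = 1 := by
  simp [lift_eq_submatrix]

theorem lift_sum {κ : Type*} (s : Finset κ) (A : κ → Matrix (RegBasis d Q) (RegBasis d Q) ℂ) :
    lift Q (∑ k ∈ s, A k) = ∑ k ∈ s, lift Q (A k) := by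
  ext
  simp only [lift, Matrix.of_apply, Matrix.sum_apply]
  split_ifs <;> simp

theorem Measurement.sum_lifted {n : ℕ} (M : Measurement d Q n) :
    ∑ m, (M.lifted m)ᴴ * M.lifted m = 1 := by
  simp only [Measurement.lifted, lift_conjTranspose, ← lift_mul, ← lift_sum, M.complete, lift_one]

theorem sum_initKraus {w : RegBasis d Q → ℂ} (hw : ∑ i, ‖w i‖ ^ 2 = 1) :
    ∑ i, (initKraus Q w i)ᴴ * initKraus Q w i = 1 := by
  have hunit : star w ⬝ᵥ w = 1 := by
    rw [← Complex.ofReal_one, ← hw, Complex.ofReal_sum]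
    exact Finset.sum_congr rfl fun i _ => by simp [Complex.conj_mul']
  have hbasis : ∑ i, Matrix.vecMulVec (star (Pi.single i 1)) (Pi.single i 1) =
      (1 : Matrix (RegBasis d Q) (RegBasis d Q) ℂ) := by
    ext i j
    simp [Matrix.sum_apply, Matrix.vecMulVec_apply, Matrix.one_apply, Pi.single_apply]
  simp only [initKraus, lift_conjTranspose, ← lift_mul, ← lift_sum, Matrix.conjTranspose_vecMulVec,
    Matrix.vecMulVec_mul_vecMulVec, hunit, one_smul, hbasis, lift_one]

theorem lift_conjTranspose_mul_lift_unitary (U : Matrix.unitaryGroup (RegBasis d Q) ℂ) :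
    (lift Q U.1)ᴴ * lift Q U.1 = 1 := by
  rw [lift_conjTranspose, ← lift_mul, ← Matrix.star_eq_conjTranspose,
    Matrix.mem_unitaryGroup_iff'.1 U.2, lift_one]

namespace Prog

theorem isBranching_sem_init {w : RegBasis d Q → ℂ} (hw : ∑ i, ‖w i‖ ^ 2 = 1) :
    IsBranching (init Q w hw).sem (initKraus Q w) fun _ ρ => ρ :=
  ⟨sum_initKraus hw, fun _ => .id, fun _ => rfl⟩

theorem isBranching_sem_apply (U : Matrix.unitaryGroup (RegBasis d Q) ℂ) :
    IsBranching (apply Q U).sem (fun _ : Unit => lift Q U.1) fun _ ρ => ρ :=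
  ⟨by simpa using lift_conjTranspose_mul_lift_unitary U, fun _ => .id, fun _ => by simp [sem]⟩

theorem isBranching_sem_cond {n : ℕ} (M : Measurement d Q n) {S : Fin n → Prog d}
    (hS : ∀ m, IsQuantumOp (S m).sem) :
    IsBranching (cond Q n M S).sem M.lifted fun m => (S m).sem :=
  ⟨M.sum_lifted, hS, fun _ => rfl⟩

theorem isQuantumOp_sem (c : Prog d) : IsQuantumOp c.sem := by
  induction c with
  | skip => exact .id
  | init Q w hw => exact (isBranching_sem_init hw).isQuantumOp
  | apply Q U => exact (isBranching_sem_apply U).isQuantumOp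
  | seq c c' h h' => exact h'.comp h
  | cond Q n M S h => exact (isBranching_sem_cond M h).isQuantumOp
  | loop Q M c h => exact isQuantumOp_loopSem h M.sum_lifted

theorem Same.sem_eq {c c' : Prog d} (h : Same c c') : c.sem = c'.sem := by
  induction h with
  | refl | skip_seq | seq_skip | assoc => rfl
  | symm _ ih => exact ih.symm
  | trans _ _ ih ih' => exact ih.trans ih'
  | seq_congr _ _ ih ih' => ext1; simp only [sem, ih, ih']
  | cond_congr _ _ _ _ ih => ext1; simp only [sem, ih]
  | loop_congr _ _ _ ih => ext1; simp only [sem, ih]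

end Prog

end Semantics

/-! ### Partial couplings -/

section PartialCoupling

variable {ι₁ ι₂ : Type*} [Fintype ι₁] [Fintype ι₂]

/-- `σ` is a partial coupling of two outputs of an experiment whose input has trace `t`. The case
`t = 1` is `IsPartialCoupling`; general `t` makes the notion additive and homogeneous. -/
structure IsPartialCouplingOfMass (σ : Matrix (ι₁ × ι₂) (ι₁ × ι₂) ℂ)
    (ρ₁ : Matrix ι₁ ι₁ ℂ) (ρ₂ : Matrix ι₂ ι₂ ℂ) (t : ℝ) : Prop where
  posSemidef : σ.PosSemidef
  trace₂_le : (ρ₁ - trace₂ σ).PosSemidef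
  trace₁_le : (ρ₂ - trace₁ σ).PosSemidef
  trace_le : ρ₁.trace.re + ρ₂.trace.re ≤ t + σ.trace.re

theorem isPartialCouplingOfMass_one_iff {σ : Matrix (ι₁ × ι₂) (ι₁ × ι₂) ℂ}
    {ρ₁ : Matrix ι₁ ι₁ ℂ} {ρ₂ : Matrix ι₂ ι₂ ℂ} :
    IsPartialCouplingOfMass σ ρ₁ ρ₂ 1 ↔ IsPartialCoupling σ ρ₁ ρ₂ :=
  ⟨fun h => ⟨h.1, h.2, h.3, h.4⟩, fun h => ⟨h.1, h.2, h.3, h.4⟩⟩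

theorem IsCoupling.isPartialCouplingOfMass {σ : Matrix (ι₁ × ι₂) (ι₁ × ι₂) ℂ}
    {ρ₁ : Matrix ι₁ ι₁ ℂ} {ρ₂ : Matrix ι₂ ι₂ ℂ} (h : IsCoupling σ ρ₁ ρ₂) :
    IsPartialCouplingOfMass σ ρ₁ ρ₂ σ.trace.re where
  posSemidef := h.posSemidef
  trace₂_le := by simpa only [h.trace₂_eq, sub_self] using Matrix.PosSemidef.zero
  trace₁_le := by simpa only [h.trace₁_eq, sub_self] using Matrix.PosSemidef.zero
  trace_le := by rw [← h.trace₂_eq, ← h.trace₁_eq, trace_trace₂, trace_trace₁]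

namespace IsPartialCouplingOfMass

variable {σ τ : Matrix (ι₁ × ι₂) (ι₁ × ι₂) ℂ} {ρ₁ : Matrix ι₁ ι₁ ℂ} {ρ₂ : Matrix ι₂ ι₂ ℂ} {t : ℝ}

theorem trace_le_left (h : IsPartialCouplingOfMass σ ρ₁ ρ₂ t) : σ.trace.re ≤ ρ₁.trace.re := by
  simpa using trace_re_nonneg h.trace₂_le

theorem isCoupling (h : IsPartialCouplingOfMass σ ρ₁ ρ₂ t) (h₁ : ρ₁.trace.re = t)
    (h₂ : ρ₂.trace.re = t) : IsCoupling σ ρ₁ ρ₂ := by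
  have hσ : σ.trace.re = t := by linarith [h.trace_le_left, h.trace_le]
  exact ⟨h.posSemidef,
    (sub_eq_zero.1 (eq_zero_of_trace_re_eq_zero h.trace₂_le (by simp [h₁, hσ]))).symm,
    (sub_eq_zero.1 (eq_zero_of_trace_re_eq_zero h.trace₁_le (by simp [h₂, hσ]))).symm⟩

theorem zero_left (h₂ : ρ₂.PosSemidef) (ht : ρ₂.trace.re ≤ t) :
    IsPartialCouplingOfMass (0 : Matrix (ι₁ × ι₂) (ι₁ × ι₂) ℂ) 0 ρ₂ t where
  posSemidef := .zero
  trace₂_le := by simpa only [isLinearMap_trace₂.map_zero, sub_zero] using Matrix.PosSemidef.zero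
  trace₁_le := by simpa only [isLinearMap_trace₁.map_zero, sub_zero] using h₂
  trace_le := by simpa using ht

theorem zero_right (h₁ : ρ₁.PosSemidef) (ht : ρ₁.trace.re ≤ t) :
    IsPartialCouplingOfMass (0 : Matrix (ι₁ × ι₂) (ι₁ × ι₂) ℂ) ρ₁ 0 t where
  posSemidef := .zero
  trace₂_le := by simpa only [isLinearMap_trace₂.map_zero, sub_zero] using h₁
  trace₁_le := by simpa only [isLinearMap_trace₁.map_zero, sub_zero] using Matrix.PosSemidef.zero
  trace_le := by simpa using ht

theorem sum {κ : Type*} [Fintype κ] {σ : κ → Matrix (ι₁ × ι₂) (ι₁ × ι₂) ℂ}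
    {ρ₁ : κ → Matrix ι₁ ι₁ ℂ} {ρ₂ : κ → Matrix ι₂ ι₂ ℂ} {t : κ → ℝ}
    (h : ∀ k, IsPartialCouplingOfMass (σ k) (ρ₁ k) (ρ₂ k) (t k)) :
    IsPartialCouplingOfMass (∑ k, σ k) (∑ k, ρ₁ k) (∑ k, ρ₂ k) (∑ k, t k) where
  posSemidef := Matrix.posSemidef_sum _ fun k _ => (h k).posSemidef
  trace₂_le := by
    rw [map_sum_of_isLinearMap isLinearMap_trace₂, ← Finset.sum_sub_distrib]
    exact Matrix.posSemidef_sum _ fun k _ => (h k).trace₂_le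
  trace₁_le := by
    rw [map_sum_of_isLinearMap isLinearMap_trace₁, ← Finset.sum_sub_distrib]
    exact Matrix.posSemidef_sum _ fun k _ => (h k).trace₁_le
  trace_le := by
    simp only [Matrix.trace_sum, Complex.re_sum, ← Finset.sum_add_distrib]
    exact Finset.sum_le_sum fun k _ => (h k).trace_le

theorem smul (h : IsPartialCouplingOfMass σ ρ₁ ρ₂ t) {c : ℝ} (hc : 0 ≤ c) :
    IsPartialCouplingOfMass ((c : ℂ) • σ) ((c : ℂ) • ρ₁) ((c : ℂ) • ρ₂) (c * t) where
  posSemidef := h.posSemidef.smul (Complex.zero_le_real.2 hc)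
  trace₂_le := by
    rw [isLinearMap_trace₂.map_smul, ← smul_sub]
    exact h.trace₂_le.smul (Complex.zero_le_real.2 hc)
  trace₁_le := by
    rw [isLinearMap_trace₁.map_smul, ← smul_sub]
    exact h.trace₁_le.smul (Complex.zero_le_real.2 hc)
  trace_le := by
    simp only [trace_ofReal_smul_re, ← mul_add]
    exact mul_le_mul_of_nonneg_left h.trace_le hc

theorem kronecker (h₁ : ρ₁.PosSemidef) (h₂ : ρ₂.PosSemidef) (t₁ : ρ₁.trace.re ≤ 1)
    (t₂ : ρ₂.trace.re ≤ 1) : IsPartialCouplingOfMass (ρ₁ ⊗ₖ ρ₂) ρ₁ ρ₂ 1 where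
  posSemidef := h₁.kronecker h₂
  trace₂_le := by
    have hsub : ρ₁ - trace₂ (ρ₁ ⊗ₖ ρ₂) = ((1 - ρ₂.trace.re : ℝ) : ℂ) • ρ₁ := by
      rw [trace₂_kronecker, Complex.ofReal_sub, ← trace_eq_re h₂, sub_smul, Complex.ofReal_one,
        one_smul]
    rw [hsub]
    exact h₁.smul (Complex.zero_le_real.2 (sub_nonneg.2 t₂))
  trace₁_le := by
    have hsub : ρ₂ - trace₁ (ρ₁ ⊗ₖ ρ₂) = ((1 - ρ₁.trace.re : ℝ) : ℂ) • ρ₂ := by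
      rw [trace₁_kronecker, Complex.ofReal_sub, ← trace_eq_re h₁, sub_smul, Complex.ofReal_one,
        one_smul]
    rw [hsub]
    exact h₂.smul (Complex.zero_le_real.2 (sub_nonneg.2 t₁))
  trace_le := by
    rw [Matrix.trace_kronecker, trace_eq_re h₁, trace_eq_re h₂, ← Complex.ofReal_mul]
    simp only [Complex.ofReal_re]
    nlinarith

theorem comp (h : IsPartialCouplingOfMass σ ρ₁ ρ₂ t) {E₁ : Matrix ι₁ ι₁ ℂ → Matrix ι₁ ι₁ ℂ}
    {E₂ : Matrix ι₂ ι₂ ℂ → Matrix ι₂ ι₂ ℂ} (hE₁ : IsQuantumOp E₁) (hE₂ : IsQuantumOp E₂)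
    (hτ : IsPartialCouplingOfMass τ (E₁ (trace₂ σ)) (E₂ (trace₁ σ)) σ.trace.re) :
    IsPartialCouplingOfMass τ (E₁ ρ₁) (E₂ ρ₂) t := by
  have hsplit₁ : E₁ ρ₁ = E₁ (ρ₁ - trace₂ σ) + E₁ (trace₂ σ) := by
    rw [← hE₁.isLinearMap.map_add, sub_add_cancel]
  have hsplit₂ : E₂ ρ₂ = E₂ (ρ₂ - trace₁ σ) + E₂ (trace₁ σ) := by
    rw [← hE₂.isLinearMap.map_add, sub_add_cancel]
  refine ⟨hτ.posSemidef, ?_, ?_, ?_⟩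
  · rw [hsplit₁, add_sub_assoc]
    exact (hE₁.posSemidef h.trace₂_le).add hτ.trace₂_le
  · rw [hsplit₂, add_sub_assoc]
    exact (hE₂.posSemidef h.trace₁_le).add hτ.trace₁_le
  · have hloss₁ := hE₁.trace_le h.trace₂_le
    have hloss₂ := hE₂.trace_le h.trace₁_le
    rw [Matrix.trace_sub, Complex.sub_re, trace_trace₂] at hloss₁
    rw [Matrix.trace_sub, Complex.sub_re, trace_trace₁] at hloss₂
    rw [hsplit₁, hsplit₂, Matrix.trace_add, Matrix.trace_add, Complex.add_re, Complex.add_re]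
    linarith [h.trace_le, hτ.trace_le]

end IsPartialCouplingOfMass

end PartialCoupling

/-! ### Validity for quantum operations -/

theorem eq_zero_or_exists_eq_smul_density {ι : Type*} [Fintype ι] {ρ : Matrix ι ι ℂ}
    (hρ : ρ.PosSemidef) :
    ρ = 0 ∨ ∃ c : ℝ, 0 < c ∧ ∃ ρ' : Matrix ι ι ℂ,
      ρ'.PosSemidef ∧ ρ'.trace = 1 ∧ ρ = (c : ℂ) • ρ' := by
  rcases (trace_re_nonneg hρ).eq_or_lt with h | h
  · exact .inl (eq_zero_of_trace_re_eq_zero hρ h.symm)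
  · have hne : (ρ.trace.re : ℂ) ≠ 0 := by exact_mod_cast h.ne'
    refine .inr ⟨ρ.trace.re, h, ((ρ.trace.re⁻¹ : ℝ) : ℂ) • ρ,
      hρ.smul (Complex.zero_le_real.2 (inv_nonneg.2 h.le)), ?_, ?_⟩
    · rw [Matrix.trace_smul, smul_eq_mul, Complex.ofReal_inv, ← inv_mul_cancel₀ hne,
        ← trace_eq_re hρ]
    · rw [smul_smul, Complex.ofReal_inv, mul_inv_cancel₀ hne, one_smul]

namespace InfPred

theorem kraus_comp_equiv {ι κ κ' : Type*} [Fintype ι] [DecidableEq ι] [Fintype κ] [Fintype κ']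
    (e : κ ≃ κ') (K : κ' → Matrix ι ι ℂ) (A : κ' → InfPred ι) :
    kraus (fun k => K (e k)) (fun k => A (e k)) = kraus K A := by
  unfold kraus
  congr 1
  exacts [e.sum_comp fun k => (K k)ᴴ * (A k).fin * K k,
    e.sum_comp fun k => (K k)ᴴ * (A k).inf * K k]

end InfPred

section ValidOps

variable {ι₁ ι₂ : Type*} [Fintype ι₁] [Fintype ι₂] [DecidableEq ι₁] [DecidableEq ι₂]
  {ψ ξ φ : InfPred (ι₁ × ι₂)} {E₁ F₁ : Matrix ι₁ ι₁ ℂ → Matrix ι₁ ι₁ ℂ}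
  {E₂ F₂ : Matrix ι₂ ι₂ ℂ → Matrix ι₂ ι₂ ℂ}

/-- Validity of `{ψ} E₁ ~ E₂ {φ}` for maps of operators in place of programs, on joint positive
operators of any trace. -/
def ValidOps (ψ : InfPred (ι₁ × ι₂)) (E₁ : Matrix ι₁ ι₁ ℂ → Matrix ι₁ ι₁ ℂ)
    (E₂ : Matrix ι₂ ι₂ ℂ → Matrix ι₂ ι₂ ℂ) (φ : InfPred (ι₁ × ι₂)) : Prop :=
  ∀ ρ : Matrix (ι₁ × ι₂) (ι₁ × ι₂) ℂ, ρ.PosSemidef →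
    ∃ σ, IsPartialCouplingOfMass σ (E₁ (trace₂ ρ)) (E₂ (trace₁ ρ)) ρ.trace.re ∧
      φ.expect σ ≤ ψ.expect ρ

namespace ValidOps

theorem id (ψ : InfPred (ι₁ × ι₂)) : ValidOps ψ (fun ρ => ρ) (fun ρ => ρ) ψ :=
  fun ρ hρ => ⟨ρ, IsCoupling.isPartialCouplingOfMass ⟨hρ, rfl, rfl⟩, le_rfl⟩

theorem comp (hF₁ : IsQuantumOp F₁) (hF₂ : IsQuantumOp F₂) (h : ValidOps ψ E₁ E₂ ξ)
    (h' : ValidOps ξ F₁ F₂ φ) : ValidOps ψ (fun ρ => F₁ (E₁ ρ)) (fun ρ => F₂ (E₂ ρ)) φ :=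
  fun ρ hρ => by
    obtain ⟨σ, hσ, hle⟩ := h ρ hρ
    obtain ⟨τ, hτ, hle'⟩ := h' σ hσ.posSemidef
    exact ⟨τ, hσ.comp hF₁ hF₂ hτ, hle'.trans hle⟩

theorem zero_left (hE₂ : IsQuantumOp E₂) : ValidOps ψ (fun _ => 0) E₂ φ := fun ρ hρ =>
  ⟨0, .zero_left (hE₂.posSemidef (posSemidef_trace₁ hρ))
    (by simpa using hE₂.trace_le (posSemidef_trace₁ hρ)), by simp⟩

theorem zero_right (hE₁ : IsQuantumOp E₁) : ValidOps ψ E₁ (fun _ => 0) φ := fun ρ hρ =>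
  ⟨0, .zero_right (hE₁.posSemidef (posSemidef_trace₂ hρ))
    (by simpa using hE₁.trace_le (posSemidef_trace₂ hρ)), by simp⟩

theorem of_density (hE₁ : IsQuantumOp E₁) (hE₂ : IsQuantumOp E₂)
    (h : ∀ ρ : Matrix (ι₁ × ι₂) (ι₁ × ι₂) ℂ, ρ.PosSemidef → ρ.trace = 1 → ψ.expect ρ ≠ ⊤ →
      ∃ σ, IsPartialCouplingOfMass σ (E₁ (trace₂ ρ)) (E₂ (trace₁ ρ)) 1 ∧
        φ.expect σ ≤ ψ.expect ρ) :
    ValidOps ψ E₁ E₂ φ := by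
  have hdensity : ∀ ρ : Matrix (ι₁ × ι₂) (ι₁ × ι₂) ℂ, ρ.PosSemidef → ρ.trace = 1 →
      ∃ σ, IsPartialCouplingOfMass σ (E₁ (trace₂ ρ)) (E₂ (trace₁ ρ)) 1 ∧
        φ.expect σ ≤ ψ.expect ρ := fun ρ hρ ht => by
    by_cases hψ : ψ.expect ρ = ⊤
    · exact ⟨_, .kronecker (hE₁.posSemidef (posSemidef_trace₂ hρ))
        (hE₂.posSemidef (posSemidef_trace₁ hρ))
        ((hE₁.trace_le (posSemidef_trace₂ hρ)).trans (by simp [ht]))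
        ((hE₂.trace_le (posSemidef_trace₁ hρ)).trans (by simp [ht])), by simp [hψ]⟩
    · exact h ρ hρ ht hψ
  intro ρ hρ
  rcases eq_zero_or_exists_eq_smul_density hρ with rfl | ⟨c, hc, ρ', hρ', ht, rfl⟩
  · refine ⟨0, ?_, by simp⟩
    simpa only [isLinearMap_trace₂.map_zero, isLinearMap_trace₁.map_zero,
      hE₁.isLinearMap.map_zero, hE₂.isLinearMap.map_zero] using .zero_left .zero (by simp)
  · obtain ⟨σ, hσ, hle⟩ := hdensity ρ' hρ' ht
    refine ⟨(c : ℂ) • σ, ?_, ?_⟩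
    · simpa only [isLinearMap_trace₂.map_smul, isLinearMap_trace₁.map_smul,
        hE₁.isLinearMap.map_smul, hE₂.isLinearMap.map_smul, trace_ofReal_smul_re, ht,
        Complex.one_re] using hσ.smul hc.le
    · rw [φ.expect_smul hσ.posSemidef hc.le, ψ.expect_smul hρ' hc.le]
      gcongr

theorem of_branches {κ : Type*} [Fintype κ] {S₁ : κ → Matrix ι₁ ι₁ ℂ → Matrix ι₁ ι₁ ℂ}
    {S₂ : κ → Matrix ι₂ ι₂ ℂ → Matrix ι₂ ι₂ ℂ} {ξ : κ → InfPred (ι₁ × ι₂)}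
    (hE₁ : IsQuantumOp E₁) (hE₂ : IsQuantumOp E₂)
    (hsplit : ∀ ρ : Matrix (ι₁ × ι₂) (ι₁ × ι₂) ℂ, ρ.PosSemidef → ρ.trace = 1 → ψ.expect ρ ≠ ⊤ →
      ∃ σ : κ → Matrix (ι₁ × ι₂) (ι₁ × ι₂) ℂ, (∀ k, (σ k).PosSemidef) ∧
        ∑ k, (σ k).trace = ρ.trace ∧ ∑ k, S₁ k (trace₂ (σ k)) = E₁ (trace₂ ρ) ∧
        ∑ k, S₂ k (trace₁ (σ k)) = E₂ (trace₁ ρ) ∧ ∑ k, (ξ k).expect (σ k) ≤ ψ.expect ρ)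
    (h : ∀ k, ValidOps (ξ k) (S₁ k) (S₂ k) φ) : ValidOps ψ E₁ E₂ φ := by
  refine .of_density hE₁ hE₂ fun ρ hρ ht hψ => ?_
  obtain ⟨σ, hσ, htr, h₁, h₂, hle⟩ := hsplit ρ hρ ht hψ
  choose τ hτ hle' using fun k => h k (σ k) (hσ k)
  refine ⟨∑ k, τ k, ?_, ?_⟩
  · simpa only [h₁, h₂, ← Complex.re_sum, htr, ht, Complex.one_re]
      using IsPartialCouplingOfMass.sum hτ
  · rw [φ.expect_sum _ fun k => (hτ k).posSemidef]
    exact (Finset.sum_le_sum fun k _ => hle' k).trans hle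

theorem of_tendsto {F₁ : ℕ → Matrix ι₁ ι₁ ℂ → Matrix ι₁ ι₁ ℂ}
    {F₂ : ℕ → Matrix ι₂ ι₂ ℂ → Matrix ι₂ ι₂ ℂ} (hF₁ : ∀ n, IsQuantumOp (F₁ n))
    (h₁ : ∀ ρ, Filter.Tendsto (fun n => F₁ n ρ) Filter.atTop (nhds (E₁ ρ)))
    (h₂ : ∀ ρ, Filter.Tendsto (fun n => F₂ n ρ) Filter.atTop (nhds (E₂ ρ)))
    (h : ∀ n, ValidOps ψ (F₁ n) (F₂ n) φ) : ValidOps ψ E₁ E₂ φ := fun ρ hρ => by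
  choose σ hσ hle using fun n => h n ρ hρ
  have hbound : ∀ n, (σ n).PosSemidef ∧ (σ n).trace.re ≤ ρ.trace.re := fun n =>
    ⟨(hσ n).posSemidef, (hσ n).trace_le_left.trans
      (by simpa using (hF₁ n).trace_le (posSemidef_trace₂ hρ))⟩
  have : FirstCountableTopology (Matrix (ι₁ × ι₂) (ι₁ × ι₂) ℂ) :=
    inferInstanceAs (FirstCountableTopology (ι₁ × ι₂ → ι₁ × ι₂ → ℂ))
  obtain ⟨τ, hτ, u, hu, hlim⟩ :=
    (isCompact_setOf_posSemidef_trace_le ρ.trace.re).tendsto_subseq hbound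
  have hlim₁ := (h₁ (trace₂ ρ)).comp hu.tendsto_atTop
  have hlim₂ := (h₂ (trace₁ ρ)).comp hu.tendsto_atTop
  refine ⟨τ, ⟨hτ.1, ?_, ?_, ?_⟩, ?_⟩
  · exact isClosed_setOf_posSemidef.mem_of_tendsto
      (hlim₁.sub ((continuous_trace₂.tendsto τ).comp hlim)) (.of_forall fun n => (hσ (u n)).2)
  · exact isClosed_setOf_posSemidef.mem_of_tendsto
      (hlim₂.sub ((continuous_trace₁.tendsto τ).comp hlim)) (.of_forall fun n => (hσ (u n)).3)
  · exact le_of_tendsto_of_tendsto'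
      (((continuous_trace_re.tendsto _).comp hlim₁).add
        ((continuous_trace_re.tendsto _).comp hlim₂))
      (((continuous_trace_re.tendsto _).comp hlim).const_add _) fun n => (hσ (u n)).4
  · exact (φ.isClosed_setOf_expect_le (ψ.expect ρ)).mem_of_tendsto hlim
      (.of_forall fun n => hle (u n))

theorem conseq {ψ' φ' : InfPred (ι₁ × ι₂)} (hψ : ψ' ≤ ψ) (h : ValidOps ψ' E₁ E₂ φ')
    (hφ : φ ≤ φ') : ValidOps ψ E₁ E₂ φ := fun ρ hρ => by
  obtain ⟨σ, hσ, hle⟩ := h ρ hρ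
  exact ⟨σ, hσ, ((InfPred.le_iff_expect_le.1 hφ σ hσ.posSemidef).trans hle).trans
    (InfPred.le_iff_expect_le.1 hψ ρ hρ)⟩

theorem branch_measCond {n : ℕ} {K₁ : Fin n → Matrix ι₁ ι₁ ℂ} {K₂ : Fin n → Matrix ι₂ ι₂ ℂ}
    {S₁ : Fin n → Matrix ι₁ ι₁ ℂ → Matrix ι₁ ι₁ ℂ} {S₂ : Fin n → Matrix ι₂ ι₂ ℂ → Matrix ι₂ ι₂ ℂ}
    {ξ : Fin n → InfPred (ι₁ × ι₂)} (h₁ : IsBranching E₁ K₁ S₁) (h₂ : IsBranching E₂ K₂ S₂)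
    (hM : MeasCond K₁ K₂ ψ ξ) (h : ∀ m, ValidOps (ξ m) (S₁ m) (S₂ m) φ) :
    ValidOps ψ E₁ E₂ φ := by
  refine .of_branches h₁.isQuantumOp h₂.isQuantumOp (fun ρ hρ ht hψ => ?_) h
  obtain ⟨σ, hσ, hle⟩ := hM ρ hρ (by simp [ht]) hψ
  refine ⟨σ, fun m => (hσ m).posSemidef, ?_, ?_, ?_, hle⟩
  · simp only [← trace_trace₂ (σ _), (hσ _).trace₂_eq, sum_trace_kraus h₁.complete, trace_trace₂]
  · simp only [(hσ _).trace₂_eq, h₁.eq_sum]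
  · simp only [(hσ _).trace₁_eq, h₂.eq_sum]

section Kraus

variable {κ₁ κ₂ : Type*} [Fintype κ₁] [Fintype κ₂] {K : κ₁ → Matrix ι₁ ι₁ ℂ}
  {L : κ₂ → Matrix ι₂ ι₂ ℂ} {S₁ : κ₁ → Matrix ι₁ ι₁ ℂ → Matrix ι₁ ι₁ ℂ}
  {S₂ : κ₂ → Matrix ι₂ ι₂ ℂ → Matrix ι₂ ι₂ ℂ}

theorem branch {ξ : κ₁ × κ₂ → InfPred (ι₁ × ι₂)} (h₁ : IsBranching E₁ K S₁)
    (h₂ : IsBranching E₂ L S₂) (h : ∀ k, ValidOps (ξ k) (S₁ k.1) (S₂ k.2) φ) :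
    ValidOps (InfPred.kraus (fun k : κ₁ × κ₂ => K k.1 ⊗ₖ L k.2) ξ) E₁ E₂ φ := by
  refine of_branches (κ := κ₁ × κ₂) h₁.isQuantumOp h₂.isQuantumOp (fun ρ hρ _ _ => ?_) h
  refine ⟨fun k => (K k.1 ⊗ₖ L k.2) * ρ * (K k.1 ⊗ₖ L k.2)ᴴ, fun k => ?_, ?_, ?_, ?_, ?_⟩
  · exact hρ.mul_mul_conjTranspose_same (K k.1 ⊗ₖ L k.2)
  · rw [Fintype.sum_prod_type, ← trace_trace₂ ρ, ← sum_trace_kraus h₁.complete]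
    simp only [← sum_trace₂_kronecker_conj h₂.complete, Matrix.trace_sum, trace_trace₂]
  · rw [Fintype.sum_prod_type, h₁.eq_sum]
    simp only [← sum_trace₂_kronecker_conj h₂.complete,
      map_sum_of_isLinearMap (h₁.isQuantumOp_branch _).isLinearMap]
  · rw [Fintype.sum_prod_type_right, h₂.eq_sum]
    simp only [← sum_trace₁_kronecker_conj h₁.complete,
      map_sum_of_isLinearMap (h₂.isQuantumOp_branch _).isLinearMap]
  · exact (InfPred.expect_kraus _ _ hρ).ge

theorem branchL {ξ : κ₁ → InfPred (ι₁ × ι₂)} (h₁ : IsBranching E₁ K S₁) (hE₂ : IsQuantumOp E₂)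
    (h : ∀ k, ValidOps (ξ k) (S₁ k) E₂ φ) :
    ValidOps (InfPred.kraus (fun k => K k ⊗ₖ (1 : Matrix ι₂ ι₂ ℂ)) ξ) E₁ E₂ φ := by
  rw [← InfPred.kraus_comp_equiv (Equiv.prodPUnit κ₁)]
  exact branch (L := fun _ : Unit => 1) (ξ := fun k => ξ k.1) h₁ (.of_isQuantumOp hE₂)
    fun k => h k.1

theorem branchR {ξ : κ₂ → InfPred (ι₁ × ι₂)} (hE₁ : IsQuantumOp E₁) (h₂ : IsBranching E₂ L S₂)
    (h : ∀ k, ValidOps (ξ k) E₁ (S₂ k) φ) :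
    ValidOps (InfPred.kraus (fun k => (1 : Matrix ι₁ ι₁ ℂ) ⊗ₖ L k) ξ) E₁ E₂ φ := by
  rw [← InfPred.kraus_comp_equiv (Equiv.punitProd κ₂)]
  exact branch (K := fun _ : Unit => 1) (ξ := fun k => ξ k.2) (.of_isQuantumOp hE₁) h₂
    fun k => h k.2

end Kraus

variable {K : Fin 2 → Matrix ι₁ ι₁ ℂ} {L : Fin 2 → Matrix ι₂ ι₂ ℂ}

theorem loop (hE₁ : IsQuantumOp E₁) (hE₂ : IsQuantumOp E₂) (hK : ∑ m, (K m)ᴴ * K m = 1)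
    (hL : ∑ m, (L m)ᴴ * L m = 1) (hM : MeasCond K L ψ ![φ, ξ]) (h : ValidOps ξ E₁ E₂ ψ) :
    ValidOps ψ (loopSem K E₁) (loopSem L E₂) φ := by
  have hK' := isQuantumOp_loopApprox hE₁ hK
  have hL' := isQuantumOp_loopApprox hE₂ hL
  refine .of_tendsto hK' (tendsto_loopApprox hE₁ hK) (tendsto_loopApprox hE₂ hL) fun n => ?_
  induction n with
  | zero => exact zero_left (hL' 0)
  | succ n ih =>
    have hiter := h.comp (hK' n) (hL' n) ih
    exact branch_measCond (isBranching_loopApprox_succ hE₁ hK (hK' n))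
      (isBranching_loopApprox_succ hE₂ hL (hL' n)) hM
      (Fin.forall_fin_two.2 ⟨.id φ, hiter⟩)

theorem loopL (hE₁ : IsQuantumOp E₁) (hK : ∑ m, (K m)ᴴ * K m = 1)
    (h : ValidOps ξ E₁ (fun ρ => ρ)
      (InfPred.kraus (fun m => K m ⊗ₖ (1 : Matrix ι₂ ι₂ ℂ)) ![φ, ξ])) :
    ValidOps (InfPred.kraus (fun m => K m ⊗ₖ (1 : Matrix ι₂ ι₂ ℂ)) ![φ, ξ])
      (loopSem K E₁) (fun ρ => ρ) φ := by
  have hK' := isQuantumOp_loopApprox hE₁ hK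
  refine .of_tendsto (F₂ := fun _ ρ => ρ) hK' (tendsto_loopApprox hE₁ hK)
    (fun _ => tendsto_const_nhds) fun n => ?_
  induction n with
  | zero => exact zero_left .id
  | succ n ih =>
    have hiter := h.comp (hK' n) .id ih
    exact branchL (isBranching_loopApprox_succ hE₁ hK (hK' n)) .id
      (Fin.forall_fin_two.2 ⟨.id φ, hiter⟩)

theorem loopR (hE₂ : IsQuantumOp E₂) (hL : ∑ m, (L m)ᴴ * L m = 1)
    (h : ValidOps ξ (fun ρ => ρ) E₂
      (InfPred.kraus (fun m => (1 : Matrix ι₁ ι₁ ℂ) ⊗ₖ L m) ![φ, ξ])) :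
    ValidOps (InfPred.kraus (fun m => (1 : Matrix ι₁ ι₁ ℂ) ⊗ₖ L m) ![φ, ξ])
      (fun ρ => ρ) (loopSem L E₂) φ := by
  have hL' := isQuantumOp_loopApprox hE₂ hL
  refine .of_tendsto (F₁ := fun _ ρ => ρ) (fun _ => .id) (fun _ => tendsto_const_nhds)
    (tendsto_loopApprox hE₂ hL) fun n => ?_
  induction n with
  | zero => exact zero_right .id
  | succ n ih =>
    have hiter := h.comp .id (hL' n) ih
    exact branchR .id (isBranching_loopApprox_succ hE₂ hL (hL' n))
      (Fin.forall_fin_two.2 ⟨.id φ, hiter⟩)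

end ValidOps

end ValidOps

/-! ### Strong duality for couplings -/

section Functionals

theorem isHermitian_add_ofReal_smul_one {ι : Type*} [DecidableEq ι]
    {Y : Matrix ι ι ℂ} (hY : Y.IsHermitian) (a : ℝ) :
    (Y + (a : ℂ) • (1 : Matrix ι ι ℂ)).IsHermitian :=
  hY.add (by simp [Matrix.IsHermitian, Matrix.conjTranspose_smul])

variable {ι : Type*} [Fintype ι]

theorem trace_mul_re_le_of_forall_density {W W' : Matrix ι ι ℂ}
    (h : ∀ σ : Matrix ι ι ℂ, σ.PosSemidef → σ.trace = 1 →
      (W * σ).trace.re ≤ (W' * σ).trace.re)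
    {σ : Matrix ι ι ℂ} (hσ : σ.PosSemidef) : (W * σ).trace.re ≤ (W' * σ).trace.re := by
  rcases eq_zero_or_exists_eq_smul_density hσ with rfl | ⟨c, hc, σ', hσ', ht, rfl⟩
  · simp
  · simp only [mul_smul_comm, trace_ofReal_smul_re]
    exact mul_le_mul_of_nonneg_left (h σ' hσ' ht) hc.le

theorem isCompact_setOf_density :
    IsCompact {σ : Matrix ι ι ℂ | σ.PosSemidef ∧ σ.trace = 1} :=
  (isCompact_setOf_posSemidef_trace_le 1).of_isClosed_subset
    (isClosed_setOf_posSemidef.inter (isClosed_eq continuous_id.matrix_trace continuous_const))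
    fun σ hσ => ⟨hσ.1, by rw [hσ.2, Complex.one_re]⟩

theorem convex_setOf_density :
    Convex ℝ {σ : Matrix ι ι ℂ | σ.PosSemidef ∧ σ.trace = 1} := by
  rintro σ ⟨hσ, hσ'⟩ τ ⟨hτ, hτ'⟩ a b ha hb hab
  simp only [← Complex.coe_smul]
  refine ⟨(hσ.smul (Complex.zero_le_real.2 ha)).add (hτ.smul (Complex.zero_le_real.2 hb)), ?_⟩
  rw [Matrix.trace_add, Matrix.trace_smul, Matrix.trace_smul, hσ', hτ', smul_eq_mul, smul_eq_mul,
    mul_one, mul_one, ← Complex.ofReal_add, hab, Complex.ofReal_one]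

theorem exists_isHermitian_trace_mul (f : Matrix ι ι ℂ →ₗ[ℝ] ℝ) :
    ∃ Y : Matrix ι ι ℂ, Y.IsHermitian ∧ ∀ X : Matrix ι ι ℂ, X.IsHermitian →
      f X = (Y * X).trace.re := by
  classical
  let Z := traceDual (Module.Dual.extendRCLike (𝕜 := ℂ) f)
  have hZ : ∀ X, (Z * X).trace.re = f X := fun X => by
    rw [trace_traceDual_mul]
    exact Module.Dual.re_extendRCLike_apply (𝕜 := ℂ) f X
  refine ⟨((1 / 2 : ℝ) : ℂ) • (Z + Zᴴ), ?_, fun X hX => ?_⟩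
  · rw [Matrix.IsHermitian, Matrix.conjTranspose_smul, Matrix.conjTranspose_add,
      Matrix.conjTranspose_conjTranspose, add_comm, RCLike.star_def, Complex.conj_ofReal]
  · have hstar : (Zᴴ * X).trace = star (Z * X).trace := by
      rw [← Matrix.trace_conjTranspose, Matrix.conjTranspose_mul, hX.eq, Matrix.trace_mul_comm]
    rw [smul_mul_assoc, trace_ofReal_smul_re, add_mul, Matrix.trace_add, hstar, Complex.add_re,
      RCLike.star_def, Complex.conj_re, hZ]
    ring

variable [DecidableEq ι]

theorem trace_add_smul_one_mul_re (Y A : Matrix ι ι ℂ) (a : ℝ) :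
    ((Y + (a : ℂ) • 1) * A).trace.re = (Y * A).trace.re + a * A.trace.re := by
  rw [add_mul, smul_mul_assoc, one_mul, Matrix.trace_add, Complex.add_re, trace_ofReal_smul_re]

open scoped MatrixOrder Matrix.Norms.L2Operator in
theorem exists_forall_posSemidef_add_smul_one {ι : Type*} [Finite ι] [DecidableEq ι]
    {Y : Matrix ι ι ℂ} (hY : Y.IsHermitian) :
    ∃ a₀ : ℝ, ∀ a, a₀ ≤ a → (Y + (a : ℂ) • (1 : Matrix ι ι ℂ)).PosSemidef := by
  have := Fintype.ofFinite ι
  refine ⟨‖Y‖, fun a ha => ?_⟩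
  have hnorm := IsSelfAdjoint.neg_algebraMap_norm_le_self (a := Y) hY
  rw [Matrix.le_iff, sub_neg_eq_add, Algebra.algebraMap_eq_smul_one] at hnorm
  have hsum := hnorm.add (Matrix.PosSemidef.one.smul (Complex.zero_le_real.2 (sub_nonneg.2 ha)))
  rwa [← Complex.coe_smul, add_assoc, ← add_smul, ← Complex.ofReal_add, add_sub_cancel] at hsum

end Functionals

namespace InfPred

variable {ι : Type*} [Fintype ι] [DecidableEq ι]

/-- The positive operator obtained from an infinite-valued predicate by replacing the eigenvalue
`+∞` with `k`; the finite eigenvalues are kept, even those above `k`. -/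
def truncate (A : InfPred ι) (k : ℕ) : Matrix ι ι ℂ :=
  A.fin + ((k : ℝ) : ℂ) • A.inf

theorem trace_truncate_mul_re (A : InfPred ι) (k : ℕ) (σ : Matrix ι ι ℂ) :
    (A.truncate k * σ).trace.re = (A.fin * σ).trace.re + k * (A.inf * σ).trace.re := by
  rw [truncate, add_mul, smul_mul_assoc, Matrix.trace_add, Complex.add_re, trace_ofReal_smul_re]

theorem ofReal_trace_truncate_mul_le (A : InfPred ι) (k : ℕ) (σ : Matrix ι ι ℂ) :
    ENNReal.ofReal (A.truncate k * σ).trace.re ≤ A.expect σ := by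
  rw [trace_truncate_mul_re, expect]
  split_ifs with h
  · simp [h]
  · exact le_top

theorem expect_le_of_forall_truncate_le (A : InfPred ι) {σ : Matrix ι ι ℂ} (hσ : σ.PosSemidef)
    {t : ℝ} (h : ∀ k, (A.truncate k * σ).trace.re ≤ t) : A.expect σ ≤ ENNReal.ofReal t := by
  simp only [trace_truncate_mul_re] at h
  have hinf : (A.inf * σ).trace.re = 0 := by
    refine (trace_mul_re_nonneg A.inf_posSemidef hσ).eq_of_not_lt' fun hpos => ?_
    obtain ⟨k, hk⟩ := exists_nat_gt ((t - (A.fin * σ).trace.re) / (A.inf * σ).trace.re)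
    rw [div_lt_iff₀ hpos] at hk
    linarith [h k]
  rw [expect, if_pos (mul_eq_zero_of_trace_re_eq_zero A.inf_posSemidef hσ hinf)]
  exact ENNReal.ofReal_le_ofReal (by simpa using h 0)

end InfPred

section Duality

variable {ι₁ ι₂ : Type*} [Fintype ι₁] [Fintype ι₂]

theorem isCompact_setOf_isCoupling (ρ₁ : Matrix ι₁ ι₁ ℂ) (ρ₂ : Matrix ι₂ ι₂ ℂ) :
    IsCompact {σ | IsCoupling σ ρ₁ ρ₂} := by
  have hset : {σ | IsCoupling σ ρ₁ ρ₂} =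
      {σ | σ.PosSemidef} ∩ ({σ | trace₂ σ = ρ₁} ∩ {σ | trace₁ σ = ρ₂}) :=
    Set.ext fun σ => ⟨fun h => ⟨h.1, h.2, h.3⟩, fun h => ⟨h.1, h.2.1, h.2.2⟩⟩
  refine (isCompact_setOf_posSemidef_trace_le ρ₁.trace.re).of_isClosed_subset ?_ fun σ hσ =>
    ⟨hσ.posSemidef, by rw [← hσ.trace₂_eq, trace_trace₂]⟩
  rw [hset]
  exact isClosed_setOf_posSemidef.inter ((isClosed_eq continuous_trace₂ continuous_const).inter
    (isClosed_eq continuous_trace₁ continuous_const))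

/-- The linear map sending a joint operator to its two marginals and its cost `tr (F σ)`. Couplings
of cost at most `t` are the states that it maps into `{ρ₁} × {ρ₂} × (-∞, t]`. -/
def marginalsAndCost (F : Matrix (ι₁ × ι₂) (ι₁ × ι₂) ℂ) :
    Matrix (ι₁ × ι₂) (ι₁ × ι₂) ℂ →ₗ[ℝ] Matrix ι₁ ι₁ ℂ × Matrix ι₂ ι₂ ℂ × ℝ where
  toFun σ := (trace₂ σ, trace₁ σ, (F * σ).trace.re)
  map_add' σ τ := by
    simp [isLinearMap_trace₂.map_add, isLinearMap_trace₁.map_add, mul_add]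
  map_smul' c σ := by
    simp only [← Complex.coe_smul, isLinearMap_trace₂.map_smul, isLinearMap_trace₁.map_smul,
      mul_smul_comm, trace_ofReal_smul_re, RingHom.id_apply, Prod.smul_mk, smul_eq_mul]

theorem exists_isHermitian_trace_mul_prod (f : Matrix ι₁ ι₁ ℂ × Matrix ι₂ ι₂ ℂ × ℝ →ₗ[ℝ] ℝ) :
    ∃ (Y₁ : Matrix ι₁ ι₁ ℂ) (Y₂ : Matrix ι₂ ι₂ ℂ) (y : ℝ), Y₁.IsHermitian ∧ Y₂.IsHermitian ∧
      ∀ (A : Matrix ι₁ ι₁ ℂ) (B : Matrix ι₂ ι₂ ℂ) (x : ℝ), A.IsHermitian → B.IsHermitian →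
        f (A, B, x) = (Y₁ * A).trace.re + (Y₂ * B).trace.re + y * x := by
  obtain ⟨Y₁, hY₁, hf₁⟩ := exists_isHermitian_trace_mul (f ∘ₗ LinearMap.inl ℝ _ _)
  obtain ⟨Y₂, hY₂, hf₂⟩ :=
    exists_isHermitian_trace_mul (f ∘ₗ LinearMap.inr ℝ _ _ ∘ₗ LinearMap.inl ℝ _ _)
  refine ⟨Y₁, Y₂, f (0, 0, 1), hY₁, hY₂, fun A B x hA hB => ?_⟩
  have hsplit : ((A, B, x) : Matrix ι₁ ι₁ ℂ × Matrix ι₂ ι₂ ℂ × ℝ) =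
      (A, 0, 0) + (0, B, 0) + x • (0, 0, 1) := by simp
  rw [← hf₁ A hA, ← hf₂ B hB, hsplit, map_add, map_add, map_smul, smul_eq_mul, mul_comm]
  rfl

variable {F : Matrix (ι₁ × ι₂) (ι₁ × ι₂) ℂ} {ρ₁ : Matrix ι₁ ι₁ ℂ} {ρ₂ : Matrix ι₂ ι₂ ℂ} {t : ℝ}

theorem exists_separating_functional (h₁ : ρ₁.IsHermitian) (h₂ : ρ₂.IsHermitian)
    (h : ∀ σ, IsCoupling σ ρ₁ ρ₂ → t < (F * σ).trace.re) :
    ∃ (Y₁ : Matrix ι₁ ι₁ ℂ) (Y₂ : Matrix ι₂ ι₂ ℂ) (y u : ℝ), Y₁.IsHermitian ∧ Y₂.IsHermitian ∧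
      (∀ σ : Matrix (ι₁ × ι₂) (ι₁ × ι₂) ℂ, σ.PosSemidef → σ.trace = 1 →
        (Y₁ * trace₂ σ).trace.re + (Y₂ * trace₁ σ).trace.re + y * (F * σ).trace.re < u) ∧
      ∀ x ≤ t, u < (Y₁ * ρ₁).trace.re + (Y₂ * ρ₂).trace.re + y * x := by
  have : LocallyConvexSpace ℝ (Matrix ι₁ ι₁ ℂ) :=
    inferInstanceAs (LocallyConvexSpace ℝ (ι₁ → ι₁ → ℂ))
  have : LocallyConvexSpace ℝ (Matrix ι₂ ι₂ ℂ) :=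
    inferInstanceAs (LocallyConvexSpace ℝ (ι₂ → ι₂ → ℂ))
  have hdisj : Disjoint (marginalsAndCost F '' {σ | σ.PosSemidef ∧ σ.trace = 1})
      ({ρ₁} ×ˢ {ρ₂} ×ˢ Set.Iic t) := Set.disjoint_left.2 <| by
    rintro _ ⟨σ, hσ, rfl⟩ ⟨hσ₁, hσ₂, hσt⟩
    exact (h σ ⟨hσ.1, hσ₁, hσ₂⟩).not_ge hσt
  obtain ⟨f, u, v, hfu, huv, hfv⟩ := geometric_hahn_banach_compact_closed
    (convex_setOf_density.linear_image _)
    (isCompact_setOf_density.image (LinearMap.continuous_of_finiteDimensional _))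
    ((convex_singleton ρ₁).prod ((convex_singleton ρ₂).prod (convex_Iic t)))
    (isClosed_singleton.prod (isClosed_singleton.prod isClosed_Iic)) hdisj
  obtain ⟨Y₁, Y₂, y, hY₁, hY₂, hf⟩ := exists_isHermitian_trace_mul_prod f.toLinearMap
  refine ⟨Y₁, Y₂, y, u, hY₁, hY₂, fun σ hσ ht => ?_, fun x hx => ?_⟩
  · rw [← hf _ _ _ (posSemidef_trace₂ hσ).1 (posSemidef_trace₁ hσ).1]
    exact hfu _ ⟨σ, ⟨hσ, ht⟩, rfl⟩
  · rw [← hf _ _ _ h₁ h₂]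
    exact huv.trans (hfv _ ⟨rfl, rfl, hx⟩)

theorem exists_isHermitian_dual_gt (h₁ : ρ₁.PosSemidef) (h₂ : ρ₂.PosSemidef)
    (ht₁ : ρ₁.trace = 1) (ht₂ : ρ₂.trace = 1)
    (h : ∀ σ, IsCoupling σ ρ₁ ρ₂ → t < (F * σ).trace.re) :
    ∃ (Z₁ : Matrix ι₁ ι₁ ℂ) (Z₂ : Matrix ι₂ ι₂ ℂ), Z₁.IsHermitian ∧ Z₂.IsHermitian ∧
      (∀ σ : Matrix (ι₁ × ι₂) (ι₁ × ι₂) ℂ, σ.PosSemidef →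
        (Z₁ * trace₂ σ).trace.re + (Z₂ * trace₁ σ).trace.re ≤ (F * σ).trace.re) ∧
      t < (Z₁ * ρ₁).trace.re + (Z₂ * ρ₂).trace.re := by
  classical
  obtain ⟨Y₁, Y₂, y, u, hY₁, hY₂, hlt, hgt⟩ := exists_separating_functional h₁.1 h₂.1 h
  -- The product coupling makes the problem feasible, so the separating hyperplane is not vertical.
  have hy : y < 0 := by
    have hprod := hlt _ (h₁.kronecker h₂) (by rw [Matrix.trace_kronecker, ht₁, ht₂, one_mul])
    rw [trace₂_kronecker, trace₁_kronecker, ht₁, ht₂, one_smul, one_smul] at hprod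
    by_contra! hy
    have hmin := hgt _ (min_le_left t (F * ρ₁ ⊗ₖ ρ₂).trace.re)
    linarith [mul_le_mul_of_nonneg_left (min_le_right t (F * ρ₁ ⊗ₖ ρ₂).trace.re) hy]
  obtain ⟨c, hc, hcy⟩ : ∃ c : ℝ, 0 < c ∧ c * y = -1 :=
    ⟨-y⁻¹, neg_pos.2 (inv_lt_zero.2 hy), by rw [neg_mul, inv_mul_cancel₀ hy.ne]⟩
  refine ⟨(c : ℂ) • Y₁ + ((-(c * u) : ℝ) : ℂ) • 1, (c : ℂ) • Y₂,
    isHermitian_add_ofReal_smul_one (hY₁.smul (Complex.conj_ofReal c)) _,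
    hY₂.smul (Complex.conj_ofReal c), fun σ hσ => ?_, ?_⟩
  · rw [← Complex.add_re, ← trace_split_mul]
    refine trace_mul_re_le_of_forall_density (fun σ hσ ht => ?_) hσ
    have hscaled := mul_lt_mul_of_pos_left (hlt σ hσ ht) hc
    rw [trace_split_mul, Complex.add_re, trace_add_smul_one_mul_re, smul_mul_assoc, smul_mul_assoc,
      trace_ofReal_smul_re, trace_ofReal_smul_re, trace_trace₂, ht, Complex.one_re]
    linear_combination hscaled.le - (F * σ).trace.re * hcy
  · have hscaled := mul_lt_mul_of_pos_left (hgt t le_rfl) hc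
    rw [trace_add_smul_one_mul_re, smul_mul_assoc, smul_mul_assoc, trace_ofReal_smul_re,
      trace_ofReal_smul_re, ht₁, Complex.one_re]
    linear_combination hscaled + t * hcy

theorem exists_isCoupling_of_forall_dual_le (h₁ : ρ₁.PosSemidef) (h₂ : ρ₂.PosSemidef)
    (ht₁ : ρ₁.trace = 1) (ht₂ : ρ₂.trace = 1)
    (h : ∀ (n : ℕ) (φ₁ : Matrix ι₁ ι₁ ℂ) (φ₂ : Matrix ι₂ ι₂ ℂ), φ₁.PosSemidef → φ₂.PosSemidef →
      (∀ σ : Matrix (ι₁ × ι₂) (ι₁ × ι₂) ℂ, σ.PosSemidef →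
        (φ₁ * trace₂ σ).trace.re + (φ₂ * trace₁ σ).trace.re ≤
          (F * σ).trace.re + n * σ.trace.re) →
      (φ₁ * ρ₁).trace.re + (φ₂ * ρ₂).trace.re ≤ t + n) :
    ∃ σ, IsCoupling σ ρ₁ ρ₂ ∧ (F * σ).trace.re ≤ t := by
  classical
  by_contra! hno
  obtain ⟨Z₁, Z₂, hZ₁, hZ₂, hle, hgt⟩ := exists_isHermitian_dual_gt h₁ h₂ ht₁ ht₂ hno
  obtain ⟨a, ha⟩ := exists_forall_posSemidef_add_smul_one hZ₁
  obtain ⟨b, hb⟩ := exists_forall_posSemidef_add_smul_one hZ₂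
  obtain ⟨n, hn⟩ := exists_nat_ge (a + b)
  have hdual := h n _ _ (ha a le_rfl) (hb (n - a) (by linarith)) fun σ hσ => by
    rw [trace_add_smul_one_mul_re, trace_add_smul_one_mul_re, trace_trace₂, trace_trace₁]
    linarith [hle σ hσ]
  rw [trace_add_smul_one_mul_re, trace_add_smul_one_mul_re, ht₁, ht₂, Complex.one_re] at hdual
  linarith

variable [DecidableEq ι₁] [DecidableEq ι₂]

theorem split_le_add_natId {φ : InfPred (ι₁ × ι₂)} {k n : ℕ}
    {φ₁ : {P : Matrix ι₁ ι₁ ℂ // P.PosSemidef}} {φ₂ : {P : Matrix ι₂ ι₂ ℂ // P.PosSemidef}}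
    (h : ∀ σ : Matrix (ι₁ × ι₂) (ι₁ × ι₂) ℂ, σ.PosSemidef →
      (φ₁.1 * trace₂ σ).trace.re + (φ₂.1 * trace₁ σ).trace.re ≤
        (φ.truncate k * σ).trace.re + n * σ.trace.re) :
    split φ₁ φ₂ ≤ φ + InfPred.natId n := InfPred.le_iff_expect_le.2 fun σ hσ => by
  rw [expect_split, InfPred.expect_add _ _ hσ, InfPred.expect_natId]
  exact (ENNReal.ofReal_le_ofReal (h σ hσ)).trans (ENNReal.ofReal_add_le.trans
    (add_le_add_left (φ.ofReal_trace_truncate_mul_le k σ) _))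

theorem exists_isCoupling_of_forall_dualitySet {φ : InfPred (ι₁ × ι₂)} (h₁ : ρ₁.PosSemidef)
    (h₂ : ρ₂.PosSemidef) (ht₁ : ρ₁.trace = 1) (ht₂ : ρ₂.trace = 1)
    (h : ∀ y ∈ dualitySet φ,
      (y.2.1.1 * ρ₁).trace.re + (y.2.2.1 * ρ₂).trace.re ≤ t + y.1) :
    ∃ σ, IsCoupling σ ρ₁ ρ₂ ∧ φ.expect σ ≤ ENNReal.ofReal t := by
  have hclosed : ∀ k, IsClosed {σ : Matrix (ι₁ × ι₂) (ι₁ × ι₂) ℂ |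
      (φ.truncate k * σ).trace.re ≤ t} := fun k =>
    isClosed_le (continuous_trace_re.comp (continuous_const.mul continuous_id)) continuous_const
  have hanti : ∀ k σ, IsCoupling σ ρ₁ ρ₂ → (φ.truncate (k + 1) * σ).trace.re ≤ t →
      (φ.truncate k * σ).trace.re ≤ t := fun k σ hσ hle => by
    have hinf := trace_mul_re_nonneg φ.inf_posSemidef hσ.posSemidef
    rw [InfPred.trace_truncate_mul_re, Nat.cast_succ] at hle
    rw [InfPred.trace_truncate_mul_re]
    linarith
  have hcompact := isCompact_setOf_isCoupling ρ₁ ρ₂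
  obtain ⟨σ, hσ⟩ := IsCompact.nonempty_iInter_of_sequence_nonempty_isCompact_isClosed
    (fun k => {σ | IsCoupling σ ρ₁ ρ₂} ∩ {σ | (φ.truncate k * σ).trace.re ≤ t})
    (fun k σ hσ => ⟨hσ.1, hanti k σ hσ.1 hσ.2⟩)
    (fun k => exists_isCoupling_of_forall_dual_le h₁ h₂ ht₁ ht₂ fun n φ₁ φ₂ hφ₁ hφ₂ hle =>
      h (n, ⟨φ₁, hφ₁⟩, ⟨φ₂, hφ₂⟩) (split_le_add_natId hle))
    (hcompact.inter_right (hclosed 0)) (fun k => hcompact.isClosed.inter (hclosed k))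
  rw [Set.mem_iInter] at hσ
  exact ⟨σ, (hσ 0).1, φ.expect_le_of_forall_truncate_le (hσ 0).1.posSemidef fun k => (hσ k).2⟩

theorem ValidOps.duality {ψ φ : InfPred (ι₁ × ι₂)} {E₁ : Matrix ι₁ ι₁ ℂ → Matrix ι₁ ι₁ ℂ}
    {E₂ : Matrix ι₂ ι₂ ℂ → Matrix ι₂ ι₂ ℂ} (hE₁ : IsQuantumOp E₁) (hE₂ : IsQuantumOp E₂)
    (htr₁ : ∀ ρ, ρ.PosSemidef → ρ.trace = 1 → (E₁ ρ).trace = 1)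
    (htr₂ : ∀ ρ, ρ.PosSemidef → ρ.trace = 1 → (E₂ ρ).trace = 1)
    (h : ∀ y ∈ dualitySet φ, ValidOps (ψ + InfPred.natId y.1) E₁ E₂ (split y.2.1 y.2.2)) :
    ValidOps ψ E₁ E₂ φ := by
  refine .of_density hE₁ hE₂ fun ρ hρ ht hψ => ?_
  have ht₁ := htr₁ _ (posSemidef_trace₂ hρ) ((trace_trace₂ ρ).trans ht)
  have ht₂ := htr₂ _ (posSemidef_trace₁ hρ) ((trace_trace₁ ρ).trans ht)
  obtain ⟨σ, hσ, hle⟩ := exists_isCoupling_of_forall_dualitySet (φ := φ)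
    (t := (ψ.expect ρ).toReal) (hE₁.posSemidef (posSemidef_trace₂ hρ))
    (hE₂.posSemidef (posSemidef_trace₁ hρ)) ht₁ ht₂ fun y hy => by
      obtain ⟨σ, hσ, hle⟩ := h y hy ρ hρ
      have hc := hσ.isCoupling (by rw [ht₁, ht]) (by rw [ht₂, ht])
      rw [expect_split, hc.trace₂_eq, hc.trace₁_eq, InfPred.expect_add _ _ hρ,
        InfPred.expect_natId, ht, Complex.one_re, mul_one, ← ENNReal.ofReal_toReal hψ,
        ← ENNReal.ofReal_add ENNReal.toReal_nonneg (Nat.cast_nonneg _)] at hle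
      exact (ENNReal.ofReal_le_ofReal_iff (by positivity)).1 hle
  refine ⟨σ, ?_, by rwa [ENNReal.ofReal_toReal hψ] at hle⟩
  simpa only [← trace_trace₂ σ, hσ.trace₂_eq, ht₁, Complex.one_re]
    using hσ.isPartialCouplingOfMass

end Duality

/-! ### Soundness -/

theorem Prog.AST.trace_sem_eq {V : Type*} [Fintype V] [DecidableEq V] {d : V → ℕ} {c : Prog d}
    (hc : c.AST) {ρ : Matrix (Basis d) (Basis d) ℂ} (hρ : ρ.PosSemidef) :
    (c.sem ρ).trace = ρ.trace := by
  rcases eq_zero_or_exists_eq_smul_density hρ with rfl | ⟨r, -, ρ', hρ', ht, rfl⟩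
  · rw [c.isQuantumOp_sem.isLinearMap.map_zero]
  · rw [c.isQuantumOp_sem.isLinearMap.map_smul, Matrix.trace_smul, Matrix.trace_smul,
      hc ρ' hρ' (by simp [ht])]

section Soundness

variable {V₁ V₂ : Type*} [Fintype V₁] [DecidableEq V₁] [Fintype V₂] [DecidableEq V₂]
  {d₁ : V₁ → ℕ} {d₂ : V₂ → ℕ} {ψ φ : RelAssn d₁ d₂} {c₁ : Prog d₁} {c₂ : Prog d₂}

theorem valid_iff_validOps : Valid ψ c₁ c₂ φ ↔ ValidOps ψ c₁.sem c₂.sem φ := by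
  refine ⟨fun h => .of_density c₁.isQuantumOp_sem c₂.isQuantumOp_sem fun ρ hρ ht _ => ?_,
    fun h ρ hρ ht => ?_⟩
  · simpa only [isPartialCouplingOfMass_one_iff] using h ρ hρ ht
  · simpa only [ht, Complex.one_re, isPartialCouplingOfMass_one_iff] using h ρ hρ

theorem validCoupling_iff_validOps (h₁ : c₁.AST) (h₂ : c₂.AST) :
    ValidCoupling ψ c₁ c₂ φ ↔ ValidOps ψ c₁.sem c₂.sem φ := by
  have ht₁ : ∀ {ρ : Matrix (Basis d₁ × Basis d₂) (Basis d₁ × Basis d₂) ℂ}, ρ.PosSemidef →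
      (c₁.sem (trace₂ ρ)).trace = ρ.trace := fun hρ => by
    rw [h₁.trace_sem_eq (posSemidef_trace₂ hρ), trace_trace₂]
  have ht₂ : ∀ {ρ : Matrix (Basis d₁ × Basis d₂) (Basis d₁ × Basis d₂) ℂ}, ρ.PosSemidef →
      (c₂.sem (trace₁ ρ)).trace = ρ.trace := fun hρ => by
    rw [h₂.trace_sem_eq (posSemidef_trace₁ hρ), trace_trace₁]
  refine ⟨fun h => .of_density c₁.isQuantumOp_sem c₂.isQuantumOp_sem fun ρ hρ ht _ => ?_,
    fun h ρ hρ _ => ?_⟩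
  · obtain ⟨σ, hσ, hle⟩ := h ρ hρ (by simp [ht])
    refine ⟨σ, ?_, hle⟩
    simpa only [← trace_trace₂ σ, hσ.trace₂_eq, ht₁ hρ, ht, Complex.one_re]
      using hσ.isPartialCouplingOfMass
  · obtain ⟨σ, hσ, hle⟩ := h ρ hρ
    exact ⟨σ, hσ.isCoupling (by rw [ht₁ hρ]) (by rw [ht₂ hρ]), hle⟩

theorem Derivable.validOps (h : Derivable ψ c₁ c₂ φ) : ValidOps ψ c₁.sem c₂.sem φ := by
  induction h with
  | skip ψ => exact .id ψ
  | init Q₁ w₁ h₁ Q₂ w₂ h₂ ψ =>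
    exact .branch (K := initKraus Q₁ w₁) (L := initKraus Q₂ w₂) (ξ := fun _ => ψ)
      (Prog.isBranching_sem_init h₁) (Prog.isBranching_sem_init h₂) fun _ => .id ψ
  | apply Q₁ U₁ Q₂ U₂ ψ =>
    rw [← InfPred.kraus_comp_equiv (Equiv.prodPUnit Unit)]
    exact .branch (K := fun _ => lift Q₁ U₁.1) (L := fun _ => lift Q₂ U₂.1) (ξ := fun _ => ψ)
      (Prog.isBranching_sem_apply U₁) (Prog.isBranching_sem_apply U₂) fun _ => .id ψ
  | @seq _ _ _ c₁ c₁' c₂ c₂' _ _ h h' =>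
    exact .comp (E₁ := c₁.sem) (E₂ := c₂.sem) c₁'.isQuantumOp_sem c₂'.isQuantumOp_sem h h'
  | cond ξ hM _ ih =>
    exact .branch_measCond (Prog.isBranching_sem_cond _ fun _ => Prog.isQuantumOp_sem _)
      (Prog.isBranching_sem_cond _ fun _ => Prog.isQuantumOp_sem _) hM ih
  | loop hM _ ih =>
    exact .loop (Prog.isQuantumOp_sem _) (Prog.isQuantumOp_sem _) (Measurement.sum_lifted _)
      (Measurement.sum_lifted _) hM ih
  | initL Q w h ψ => exact .branchL (Prog.isBranching_sem_init h) .id fun _ => .id ψ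
  | applyL Q U ψ => exact .branchL (Prog.isBranching_sem_apply U) .id fun _ => .id ψ
  | condL ξ _ ih =>
    exact .branchL (Prog.isBranching_sem_cond _ fun _ => Prog.isQuantumOp_sem _)
      (Prog.isQuantumOp_sem _) ih
  | loopL _ ih => exact .loopL (Prog.isQuantumOp_sem _) (Measurement.sum_lifted _) ih
  | initR Q w h ψ => exact .branchR .id (Prog.isBranching_sem_init h) fun _ => .id ψ
  | applyR Q U ψ => exact .branchR .id (Prog.isBranching_sem_apply U) fun _ => .id ψ
  | condR ξ _ ih =>
    exact .branchR (Prog.isQuantumOp_sem _)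
      (Prog.isBranching_sem_cond _ fun _ => Prog.isQuantumOp_sem _) ih
  | loopR _ ih => exact .loopR (Prog.isQuantumOp_sem _) (Measurement.sum_lifted _) ih
  | same h₁ h₂ _ ih => rwa [← h₁.sem_eq, ← h₂.sem_eq]
  | conseq hψ _ hφ ih => exact ih.conseq hψ hφ
  | boundedDuality h₁ h₂ _ _ ih | unboundedDuality h₁ h₂ _ ih =>
    exact .duality (Prog.isQuantumOp_sem _) (Prog.isQuantumOp_sem _)
      (fun _ hρ ht => (h₁.trace_sem_eq hρ).trans ht)
      (fun _ hρ ht => (h₂.trace_sem_eq hρ).trans ht) ih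

end Soundness

/-! ### Completeness -/

section WeakestPrecondition

variable {ι : Type*} [Fintype ι] [DecidableEq ι]

/-- The weakest precondition `E†(P)` of a positive operator under a quantum operation, as a
positive operator. -/
def IsQuantumOp.weakestPre {E : Matrix ι ι ℂ → Matrix ι ι ℂ} (hE : IsQuantumOp E)
    (P : {P : Matrix ι ι ℂ // P.PosSemidef}) : {P : Matrix ι ι ℂ // P.PosSemidef} :=
  ⟨hE.dual P.1, hE.posSemidef_dual P.2⟩

theorem IsQuantumOp.trace_weakestPre_mul {E : Matrix ι ι ℂ → Matrix ι ι ℂ} (hE : IsQuantumOp E)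
    (P : {P : Matrix ι ι ℂ // P.PosSemidef}) (ρ : Matrix ι ι ℂ) :
    ((hE.weakestPre P).1 * ρ).trace = (P.1 * E ρ).trace :=
  hE.trace_dual_mul P.1 ρ

theorem IsQuantumOp.weakestPre_id (P : {P : Matrix ι ι ℂ // P.PosSemidef}) :
    IsQuantumOp.id.weakestPre P = P :=
  Subtype.ext <| Matrix.ext_iff_trace_mul_right.2 <| IsQuantumOp.id.trace_weakestPre_mul P

theorem IsQuantumOp.weakestPre_comp {E F : Matrix ι ι ℂ → Matrix ι ι ℂ} (hF : IsQuantumOp F)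
    (hE : IsQuantumOp E) (P : {P : Matrix ι ι ℂ // P.PosSemidef}) :
    (hF.comp hE).weakestPre P = hE.weakestPre (hF.weakestPre P) :=
  Subtype.ext <| Matrix.ext_iff_trace_mul_right.2 fun ρ => by
    simp only [trace_weakestPre_mul]

theorem IsBranching.trace_weakestPre_mul {κ : Type*} [Fintype κ]
    {E : Matrix ι ι ℂ → Matrix ι ι ℂ} {K : κ → Matrix ι ι ℂ}
    {S : κ → Matrix ι ι ℂ → Matrix ι ι ℂ} (h : IsBranching E K S)
    (P : {P : Matrix ι ι ℂ // P.PosSemidef}) (ρ : Matrix ι ι ℂ) :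
    ((h.isQuantumOp.weakestPre P).1 * ρ).trace =
      ∑ k, (((h.isQuantumOp_branch k).weakestPre P).1 * (K k * ρ * (K k)ᴴ)).trace := by
  simp only [IsQuantumOp.trace_weakestPre_mul, h.eq_sum, Finset.mul_sum, Matrix.trace_sum]

theorem suppProj_zero : suppProj (0 : Matrix ι ι ℂ) = 0 := by
  simpa using suppProj_mul_eq_zero_iff (S := (0 : Matrix ι ι ℂ)) Matrix.isHermitian_zero 1

theorem InfPred.kraus_ofPos {κ : Type*} [Fintype κ] (K : κ → Matrix ι ι ℂ)
    {P : κ → Matrix ι ι ℂ} (hP : ∀ k, (P k).PosSemidef) :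
    kraus K (fun k => ofPos (P k) (hP k)) = ofPos (∑ k, (K k)ᴴ * P k * K k)
      (Matrix.posSemidef_sum _ fun k _ => (hP k).conjTranspose_mul_mul_same (K k)) := by
  ext1 <;> simp [kraus, ofParts, ofPos, suppProj_zero]

end WeakestPrecondition

section Split

variable {ι₁ ι₂ : Type*} [Fintype ι₁] [Fintype ι₂] [DecidableEq ι₁] [DecidableEq ι₂]
  {E₁ : Matrix ι₁ ι₁ ℂ → Matrix ι₁ ι₁ ℂ} {E₂ : Matrix ι₂ ι₂ ℂ → Matrix ι₂ ι₂ ℂ}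
  {κ : Type*} [Fintype κ]

theorem IsBranching.kraus_split_left {K : κ → Matrix ι₁ ι₁ ℂ}
    {S : κ → Matrix ι₁ ι₁ ℂ → Matrix ι₁ ι₁ ℂ} (h : IsBranching E₁ K S)
    (P : {P : Matrix ι₁ ι₁ ℂ // P.PosSemidef}) (R : {R : Matrix ι₂ ι₂ ℂ // R.PosSemidef}) :
    InfPred.kraus (fun k => K k ⊗ₖ (1 : Matrix ι₂ ι₂ ℂ))
        (fun k => split ((h.isQuantumOp_branch k).weakestPre P) R) =
      split (h.isQuantumOp.weakestPre P) R := by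
  have htrace₂ : ∀ k (ρ : Matrix (ι₁ × ι₂) (ι₁ × ι₂) ℂ),
      trace₂ (K k ⊗ₖ (1 : Matrix ι₂ ι₂ ℂ) * ρ * (K k ⊗ₖ (1 : Matrix ι₂ ι₂ ℂ))ᴴ) =
        K k * trace₂ ρ * (K k)ᴴ := fun k ρ => by
    simpa using sum_trace₂_kronecker_conj (L := fun _ : Unit => (1 : Matrix ι₂ ι₂ ℂ))
      (by simp) (K k) ρ
  have htrace₁ : ∀ ρ : Matrix (ι₁ × ι₂) (ι₁ × ι₂) ℂ,
      ∑ k, trace₁ (K k ⊗ₖ (1 : Matrix ι₂ ι₂ ℂ) * ρ * (K k ⊗ₖ (1 : Matrix ι₂ ι₂ ℂ))ᴴ) =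
        trace₁ ρ := fun ρ => by
    simpa using sum_trace₁_kronecker_conj h.complete (1 : Matrix ι₂ ι₂ ℂ) ρ
  unfold split
  rw [InfPred.kraus_ofPos]
  congr 1
  refine Matrix.ext_iff_trace_mul_right.2 fun ρ => ?_
  simp only [Finset.sum_mul, Matrix.trace_sum, trace_mul_conjTranspose_mul_mul, trace_split_mul,
    Finset.sum_add_distrib, htrace₂, h.trace_weakestPre_mul]
  rw [← htrace₁ ρ, Finset.mul_sum, Matrix.trace_sum]

theorem IsBranching.kraus_split_right {K : κ → Matrix ι₂ ι₂ ℂ}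
    {S : κ → Matrix ι₂ ι₂ ℂ → Matrix ι₂ ι₂ ℂ} (h : IsBranching E₂ K S)
    (P : {P : Matrix ι₁ ι₁ ℂ // P.PosSemidef}) (R : {R : Matrix ι₂ ι₂ ℂ // R.PosSemidef}) :
    InfPred.kraus (fun k => (1 : Matrix ι₁ ι₁ ℂ) ⊗ₖ K k)
        (fun k => split P ((h.isQuantumOp_branch k).weakestPre R)) =
      split P (h.isQuantumOp.weakestPre R) := by
  have htrace₁ : ∀ k (ρ : Matrix (ι₁ × ι₂) (ι₁ × ι₂) ℂ),
      trace₁ ((1 : Matrix ι₁ ι₁ ℂ) ⊗ₖ K k * ρ * ((1 : Matrix ι₁ ι₁ ℂ) ⊗ₖ K k)ᴴ) =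
        K k * trace₁ ρ * (K k)ᴴ := fun k ρ => by
    simpa using sum_trace₁_kronecker_conj (K := fun _ : Unit => (1 : Matrix ι₁ ι₁ ℂ))
      (by simp) (K k) ρ
  have htrace₂ : ∀ ρ : Matrix (ι₁ × ι₂) (ι₁ × ι₂) ℂ,
      ∑ k, trace₂ ((1 : Matrix ι₁ ι₁ ℂ) ⊗ₖ K k * ρ * ((1 : Matrix ι₁ ι₁ ℂ) ⊗ₖ K k)ᴴ) =
        trace₂ ρ := fun ρ => by
    simpa using sum_trace₂_kronecker_conj h.complete (1 : Matrix ι₁ ι₁ ℂ) ρ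
  unfold split
  rw [InfPred.kraus_ofPos]
  congr 1
  refine Matrix.ext_iff_trace_mul_right.2 fun ρ => ?_
  simp only [Finset.sum_mul, Matrix.trace_sum, trace_mul_conjTranspose_mul_mul, trace_split_mul,
    Finset.sum_add_distrib, htrace₁, h.trace_weakestPre_mul]
  rw [← htrace₂ ρ, Finset.mul_sum, Matrix.trace_sum]

theorem ValidOps.split_weakestPre_le {ψ φ : InfPred (ι₁ × ι₂)} (h₁ : IsQuantumOp E₁)
    (h₂ : IsQuantumOp E₂) (ht₁ : ∀ ρ, ρ.PosSemidef → (E₁ ρ).trace = ρ.trace)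
    (ht₂ : ∀ ρ, ρ.PosSemidef → (E₂ ρ).trace = ρ.trace) (h : ValidOps ψ E₁ E₂ φ) {n : ℕ}
    {P : {P : Matrix ι₁ ι₁ ℂ // P.PosSemidef}} {R : {R : Matrix ι₂ ι₂ ℂ // R.PosSemidef}}
    (hPR : split P R ≤ φ + InfPred.natId n) :
    split (h₁.weakestPre P) (h₂.weakestPre R) ≤ ψ + InfPred.natId n := by
  refine InfPred.le_iff_expect_le.2 fun ρ hρ => ?_
  obtain ⟨σ, hσ, hle⟩ := h ρ hρ
  have hρ₁ := ht₁ _ (posSemidef_trace₂ hρ)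
  have hρ₂ := ht₂ _ (posSemidef_trace₁ hρ)
  rw [trace_trace₂] at hρ₁
  rw [trace_trace₁] at hρ₂
  have hc := hσ.isCoupling (by rw [hρ₁]) (by rw [hρ₂])
  have htr : σ.trace = ρ.trace := by rw [← trace_trace₂, hc.trace₂_eq, hρ₁]
  have hsplit : (split (h₁.weakestPre P) (h₂.weakestPre R)).expect ρ = (split P R).expect σ := by
    simp only [expect_split, IsQuantumOp.trace_weakestPre_mul, hc.trace₂_eq, hc.trace₁_eq]
  rw [hsplit]
  refine (InfPred.le_iff_expect_le.1 hPR σ hσ.posSemidef).trans ?_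
  rw [InfPred.expect_add _ _ hσ.posSemidef, InfPred.expect_add _ _ hρ, InfPred.expect_natId,
    InfPred.expect_natId, htr]
  exact add_le_add_left hle _

end Split

section Completeness

variable {V₁ V₂ : Type*} [Fintype V₁] [DecidableEq V₁] [Fintype V₂] [DecidableEq V₂]
  {d₁ : V₁ → ℕ} {d₂ : V₂ → ℕ}

theorem derivable_weakestPre_left (c : Prog d₁)
    (P : {P : Matrix (Basis d₁) (Basis d₁) ℂ // P.PosSemidef})
    (R : {R : Matrix (Basis d₂) (Basis d₂) ℂ // R.PosSemidef}) :
    Derivable (split (c.isQuantumOp_sem.weakestPre P) R) c .skip (split P R) := by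
  induction c generalizing P with
  | skip => exact (IsQuantumOp.weakestPre_id P).symm ▸ .skip _
  | init Q w hw =>
    have hwp := (Prog.isBranching_sem_init hw).kraus_split_left P R
    simp only [IsQuantumOp.weakestPre_id] at hwp
    exact hwp ▸ .initL Q w hw _
  | apply Q U =>
    have hwp := (Prog.isBranching_sem_apply U).kraus_split_left P R
    simp only [IsQuantumOp.weakestPre_id] at hwp
    exact hwp ▸ .applyL Q U _
  | seq c c' ih ih' =>
    have hwp := c'.isQuantumOp_sem.weakestPre_comp c.isQuantumOp_sem P
    exact hwp ▸ .same (.refl _) (.skip_seq _) (.seq (ih _) (ih' P))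
  | cond Q n M S ih =>
    have hS : ∀ m, IsQuantumOp (S m).sem := fun m => (S m).isQuantumOp_sem
    have hwp := (Prog.isBranching_sem_cond M hS).kraus_split_left P R
    exact hwp ▸ .condL _ fun m => ih m P
  | loop Q M c ih =>
    have hloop := isBranching_loopSem c.isQuantumOp_sem M.sum_lifted
    have hwp := hloop.kraus_split_left P R
    have hcons : (fun m => split ((hloop.isQuantumOp_branch m).weakestPre P) R) =
        ![split P R, split (c.isQuantumOp_sem.weakestPre (hloop.isQuantumOp.weakestPre P)) R] := by
      ext1 m
      fin_cases m
      · exact congrArg (split · R) (IsQuantumOp.weakestPre_id P)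
      · exact congrArg (split · R) (hloop.isQuantumOp.weakestPre_comp c.isQuantumOp_sem P)
    rw [hcons] at hwp
    have hbody := ih (hloop.isQuantumOp.weakestPre P)
    rw [← hwp] at hbody
    exact hwp ▸ .loopL hbody

theorem derivable_weakestPre_right (c : Prog d₂)
    (P : {P : Matrix (Basis d₁) (Basis d₁) ℂ // P.PosSemidef})
    (R : {R : Matrix (Basis d₂) (Basis d₂) ℂ // R.PosSemidef}) :
    Derivable (split P (c.isQuantumOp_sem.weakestPre R)) .skip c (split P R) := by
  induction c generalizing R with
  | skip => exact (IsQuantumOp.weakestPre_id R).symm ▸ .skip _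
  | init Q w hw =>
    have hwp := (Prog.isBranching_sem_init hw).kraus_split_right P R
    simp only [IsQuantumOp.weakestPre_id] at hwp
    exact hwp ▸ .initR Q w hw _
  | apply Q U =>
    have hwp := (Prog.isBranching_sem_apply U).kraus_split_right P R
    simp only [IsQuantumOp.weakestPre_id] at hwp
    exact hwp ▸ .applyR Q U _
  | seq c c' ih ih' =>
    have hwp := c'.isQuantumOp_sem.weakestPre_comp c.isQuantumOp_sem R
    exact hwp ▸ .same (.skip_seq _) (.refl _) (.seq (ih _) (ih' R))
  | cond Q n M S ih =>
    have hS : ∀ m, IsQuantumOp (S m).sem := fun m => (S m).isQuantumOp_sem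
    have hwp := (Prog.isBranching_sem_cond M hS).kraus_split_right P R
    exact hwp ▸ .condR _ fun m => ih m R
  | loop Q M c ih =>
    have hloop := isBranching_loopSem c.isQuantumOp_sem M.sum_lifted
    have hwp := hloop.kraus_split_right P R
    have hcons : (fun m => split P ((hloop.isQuantumOp_branch m).weakestPre R)) =
        ![split P R, split P (c.isQuantumOp_sem.weakestPre (hloop.isQuantumOp.weakestPre R))] := by
      ext1 m
      fin_cases m
      · exact congrArg (split P) (IsQuantumOp.weakestPre_id R)
      · exact congrArg (split P) (hloop.isQuantumOp.weakestPre_comp c.isQuantumOp_sem R)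
    rw [hcons] at hwp
    have hbody := ih (hloop.isQuantumOp.weakestPre R)
    rw [← hwp] at hbody
    exact hwp ▸ .loopR hbody

theorem ValidOps.derivable {ψ φ : RelAssn d₁ d₂} {c₁ : Prog d₁} {c₂ : Prog d₂} (h₁ : c₁.AST)
    (h₂ : c₂.AST) (h : ValidOps ψ c₁.sem c₂.sem φ) : Derivable ψ c₁ c₂ φ := by
  refine .unboundedDuality h₁ h₂ fun y hy => ?_
  have hwp : split (c₁.isQuantumOp_sem.weakestPre y.2.1) (c₂.isQuantumOp_sem.weakestPre y.2.2) ≤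
      ψ + InfPred.natId y.1 :=
    h.split_weakestPre_le _ _ (fun _ => h₁.trace_sem_eq) (fun _ => h₂.trace_sem_eq) hy
  have hleft := derivable_weakestPre_left c₁ y.2.1 (c₂.isQuantumOp_sem.weakestPre y.2.2)
  have hright := derivable_weakestPre_right c₂ y.2.1 y.2.2
  exact .conseq hwp (.same (.seq_skip c₁) (.skip_seq c₂) (hleft.seq hright)) fun _ => le_rfl

theorem derivable_iff_validOps {ψ φ : RelAssn d₁ d₂} {c₁ : Prog d₁} {c₂ : Prog d₂}
    (h₁ : c₁.AST) (h₂ : c₂.AST) : Derivable ψ c₁ c₂ φ ↔ ValidOps ψ c₁.sem c₂.sem φ :=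
  ⟨Derivable.validOps, ValidOps.derivable h₁ h₂⟩

end Completeness

end QOTL

theorem mainTheorem6 {V₁ V₂ : Type*} [Fintype V₁] [DecidableEq V₁] [Fintype V₂] [DecidableEq V₂]
    (d₁ : V₁ → ℕ) (d₂ : V₂ → ℕ) [∀ v, NeZero (d₁ v)] [∀ v, NeZero (d₂ v)]
    (c₁ : QOTL.Prog d₁) (c₂ : QOTL.Prog d₂) (hc₁ : c₁.AST) (hc₂ : c₂.AST)
    (ψ φ : QOTL.RelAssn d₁ d₂) :
    (QOTL.Derivable ψ c₁ c₂ φ ↔ QOTL.Valid ψ c₁ c₂ φ) ∧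
    (QOTL.Derivable ψ c₁ c₂ φ ↔ QOTL.ValidCoupling ψ c₁ c₂ φ) := by
  have sound_complete := QOTL.derivable_iff_validOps (ψ := ψ) (φ := φ) hc₁ hc₂
  exact ⟨sound_complete.trans QOTL.valid_iff_validOps.symm,
    sound_complete.trans (QOTL.validCoupling_iff_validOps hc₁ hc₂).symm⟩
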